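/- Let $k$ be an infinite field and $n\ge 1$. Let $\mathrm{End}_k(\mathbb{A}^n)=k[x_1,\dots,x_n]^n$, a monoid under composition $f\circ g=(f_1(g_1,\dots,g_n),\dots,f_n(g_1,\dots,g_n))$; let $\mathrm{Aut}_k(\mathbb{A}^n)$ be its group of invertible elements, and let $\mathrm{SAut}_k(\mathbb{A}^n)$ be the subgroup of those $f$ with $\det(\partial f_i/\partial x_j)_{i,j}=1$. An automorphism is called tame if it belongs to the subgroup of $\mathrm{Aut}_k(\mathbb{A}^n)$ generated by the affine automorphisms $x\mapsto Mx+v$ ($M\in \mathrm{GL}_n(k)$, $v\in k^n$) and the triangular automorphisms $(a_1x_1+b_1,\dots,a_nx_n+b_n)$ with $a_i\in k^*$, $b_i\in k[x_1,\dots,x_{i-1}]$. For $d\ge 0$ let $\mathrm{End}_{\le d}\subset \mathrm{End}_k(\mathbb{A}^n)$ be the finite-dimensional affine space of those $f$ with $\deg f_i\le d$ for all $i$. Consider two topologies on $\mathrm{End}_k(\mathbb{A}^n)$: (a) (Shafarevich) a subset is closed if its intersection with $\mathrm{End}_{\le d}$ is Zariski closed in $\mathrm{End}_{\le d}$ for every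 $d$; (b) (Kambayashi, weaker) a subset is closed if it is the set of common zeros of a family of functions $F\colon \mathrm{End}_k(\mathbb{A}^n)\to k$, each of which restricts to a polynomial function of the coefficients on every $\mathrm{End}_{\le d}$. Endow $\mathrm{SAut}_k(\mathbb{A}^n)$ with the topology induced by (a) or by (b). **Theorem.** Assume that $n\ge 2$, or that $n=1$ and $\mathrm{char}(k)=0$. Let $N\subseteq\mathrm{SAut}_k(\mathbb{A}^n)$ be a normal subgroup that is closed for at least one of the two topologies. Then either $N=\{\mathrm{id}\}$, or $N$ contains every tame automorphism that lies in $\mathrm{SAut}_k(\mathbb{A}^n)$. Moreover, for $n=2$ and for each of the two topologies, $\mathrm{SAut}_k(\mathbb{A}^2)$ is simple as an ind-group: it is nontrivial and its only closed normal subgroups are $\{\mathrm{id}\}$ and $\mathrm{SAut}_k(\mathbb{A}^2)$. -/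

import Mathlib

open MvPolynomial
open scoped Topology

namespace AffineSpaceAut

universe u

/-- An endomorphism `(f₁, …, fₙ)` of affine `n`-space over `R`, given by its `n` component
polynomials `fᵢ ∈ R[x₁, …, xₙ]`. -/
@[ext]
structure PolyEnd (n : ℕ) (R : Type u) [CommRing R] where
  comp : Fin n → MvPolynomial (Fin n) R

section Ring

variable {n : ℕ} {R : Type u} [CommRing R]

/-- The multiplication is composition: `(f * g)ᵢ = fᵢ(g₁, …, gₙ)`, and the unit is
`(x₁, …, xₙ)`. -/
noncomputable instance : Monoid (PolyEnd n R) where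
  mul f g := ⟨fun i => bind₁ g.comp (f.comp i)⟩
  one := ⟨X⟩
  mul_assoc f g h := by
    ext1
    funext i
    exact bind₁_bind₁ _ _ _
  one_mul f := by
    ext1
    funext i
    exact bind₁_X_right _ _
  mul_one f := by
    ext1
    funext i
    change bind₁ X (f.comp i) = f.comp i
    rw [bind₁_X_left]
    rfl

theorem mul_comp (f g : PolyEnd n R) (i : Fin n) :
    (f * g).comp i = bind₁ g.comp (f.comp i) := rfl

theorem one_comp (i : Fin n) : (1 : PolyEnd n R).comp i = X i := rfl

/-- The derivative `Df = (∂fᵢ/∂xⱼ)`. -/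
noncomputable def derivMatrix (f : PolyEnd n R) :
    Matrix (Fin n) (Fin n) (MvPolynomial (Fin n) R) :=
  Matrix.of fun i j => pderiv j (f.comp i)

/-- The Jacobian `Jac(f) = det(Df)`. -/
noncomputable def jac (f : PolyEnd n R) : MvPolynomial (Fin n) R :=
  (derivMatrix f).det

theorem pderiv_bind₁ (g : Fin n → MvPolynomial (Fin n) R) (j : Fin n)
    (p : MvPolynomial (Fin n) R) :
    pderiv j (bind₁ g p) = ∑ i, bind₁ g (pderiv i p) * pderiv j (g i) := by
  classical
  induction p using MvPolynomial.induction_on with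
  | C a => simp
  | add p q hp hq => simp [hp, hq, add_mul, Finset.sum_add_distrib]
  | mul_X p i hp =>
    simp only [map_mul, bind₁_X_right, pderiv_mul, hp, map_add, add_mul,
      Finset.sum_add_distrib, Finset.sum_mul, pderiv_X]
    congr 1
    · exact Finset.sum_congr rfl fun x _ => by ring
    · rw [Finset.sum_eq_single i]
      · simp
      · intro b _ hb
        simp [hb.symm]
      · simp

theorem derivMatrix_mul (f g : PolyEnd n R) :
    derivMatrix (f * g) = (derivMatrix f).map (bind₁ g.comp) * derivMatrix g := by
  ext1 i j
  simp only [derivMatrix, Matrix.of_apply, Matrix.mul_apply, Matrix.map_apply, mul_comp]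
  exact pderiv_bind₁ _ _ _

theorem jac_mul (f g : PolyEnd n R) : jac (f * g) = bind₁ g.comp (jac f) * jac g := by
  unfold jac
  rw [derivMatrix_mul, Matrix.det_mul]
  congr 1
  exact ((bind₁ g.comp).map_det (derivMatrix f)).symm

theorem jac_one : jac (1 : PolyEnd n R) = 1 := by
  classical
  unfold jac
  have : derivMatrix (1 : PolyEnd n R) = 1 := by
    ext1 i j
    simp [derivMatrix, one_comp, pderiv_X, Matrix.one_apply, Pi.single_apply]
  rw [this, Matrix.det_one]

end Ring

/-- The group of automorphisms of affine `n`-space over `R`: the invertible endomorphisms. -/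
abbrev PolyAut (n : ℕ) (R : Type u) [CommRing R] : Type u := (PolyEnd n R)ˣ

/-- The subgroup of automorphisms of Jacobian `1`. -/
noncomputable def SAut (n : ℕ) (R : Type u) [CommRing R] : Subgroup (PolyAut n R) where
  carrier := {f | jac (f : PolyEnd n R) = 1}
  mul_mem' {f g} hf hg := by
    simp only [Set.mem_ofPred_eq] at hf hg ⊢
    rw [Units.val_mul, jac_mul, hf, hg, map_one, one_mul]
  one_mem' := jac_one
  inv_mem' {f} hf := by
    simp only [Set.mem_ofPred_eq] at hf ⊢
    have h := jac_mul (f : PolyEnd n R) ((f⁻¹ : PolyAut n R) : PolyEnd n R)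
    rw [Units.mul_inv, jac_one, hf, map_one, one_mul] at h
    exact h.symm

/-- The affine automorphisms `x ↦ M x + v` with `det M` invertible. -/
def affineAuts (n : ℕ) (R : Type u) [CommRing R] : Set (PolyAut n R) :=
  {f | ∃ (M : Matrix (Fin n) (Fin n) R) (v : Fin n → R), IsUnit M.det ∧
    ∀ i, (f : PolyEnd n R).comp i = ∑ j, C (M i j) * X j + C (v i)}

/-- The triangular automorphisms `(a₁ x₁ + b₁, …, aₙ xₙ + bₙ)` with `aᵢ ∈ Rˣ` and
`bᵢ ∈ R[x₁, …, xᵢ₋₁]`. -/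
def triangularAuts (n : ℕ) (R : Type u) [CommRing R] : Set (PolyAut n R) :=
  {f | ∃ (a : Fin n → Rˣ) (b : Fin n → MvPolynomial (Fin n) R),
    (∀ i, b i ∈ supported R {j : Fin n | j < i}) ∧
    ∀ i, (f : PolyEnd n R).comp i = C (a i : R) * X i + b i}

/-- The tame automorphisms: the subgroup generated by affine and triangular automorphisms. -/
noncomputable def Tame (n : ℕ) (R : Type u) [CommRing R] : Subgroup (PolyAut n R) :=
  Subgroup.closure (affineAuts n R ∪ triangularAuts n R)

/-- The topology on `X` whose closed sets are the common zero loci of sets of functions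
belonging to a given algebra `A` of `k`-valued functions on `X`. -/
@[reducible]
def zeroLocusTopology {X : Type u} {k : Type u} [Field k] (A : Subalgebra k (X → k)) :
    TopologicalSpace X :=
  TopologicalSpace.ofClosed {Z | ∃ S : Set (X → k), S ⊆ A ∧ Z = {x | ∀ F ∈ S, F x = 0}}
    ⟨{1}, by simp, by ext; simp⟩
    (by
      intro 𝒵 h𝒵
      refine ⟨{F | F ∈ A ∧ ∃ Z ∈ 𝒵, ∀ x ∈ Z, F x = 0}, fun F hF => hF.1, ?_⟩
      ext x
      simp only [Set.mem_sInter, Set.mem_ofPred_eq]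
      constructor
      · rintro hx F ⟨-, Z, hZ, hF⟩
        exact hF x (hx Z hZ)
      · intro hx Z hZ
        obtain ⟨S, hS, rfl⟩ := h𝒵 hZ
        exact fun F hF => hx F ⟨hS hF, _, hZ, fun y hy => hy F hF⟩)
    (by
      rintro _ ⟨S, hS, rfl⟩ _ ⟨T, hT, rfl⟩
      refine ⟨{H | ∃ F ∈ S, ∃ G ∈ T, H = F * G}, ?_, ?_⟩
      · rintro _ ⟨F, hF, G, hG, rfl⟩
        exact A.mul_mem (hS hF) (hT hG)
      · ext x
        simp only [Set.mem_union, Set.mem_ofPred_eq]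
        constructor
        · rintro (h | h) _ ⟨F, hF, G, hG, rfl⟩
          · simp [h F hF]
          · simp [h G hG]
        · intro h
          by_contra! hcon
          obtain ⟨⟨F, hF, hFx⟩, G, hG, hGx⟩ := hcon
          exact (mul_ne_zero hFx hGx) (h _ ⟨F, hF, G, hG, rfl⟩))

theorem isClosed_zeroLocusTopology_iff {X : Type u} {k : Type u} [Field k]
    (A : Subalgebra k (X → k)) (Z : Set X) :
    IsClosed[zeroLocusTopology A] Z ↔
      ∃ S : Set (X → k), S ⊆ A ∧ Z = {x | ∀ F ∈ S, F x = 0} := by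
  rw [← @isOpen_compl_iff X Z (zeroLocusTopology A)]
  change Zᶜᶜ ∈ {Z | ∃ S : Set (X → k), S ⊆ A ∧ Z = {x | ∀ F ∈ S, F x = 0}} ↔ _
  rw [compl_compl]
  rfl

/-- The endomorphisms all of whose components have degree at most `d`. -/
abbrev EndLE (n : ℕ) (k : Type u) [Field k] (d : ℕ) : Type u :=
  {f : PolyEnd n k // ∀ i, (f.comp i).totalDegree ≤ d}

/-- The algebra of polynomial functions in the coefficients of `f` on the finite-dimensional
affine space `EndLE n k d`. The variable indexed by `(i, m)` is the coefficient of the monomial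
`x ^ m` in `fᵢ`; it is zero on `EndLE n k d` when the degree of `m` exceeds `d`. -/
noncomputable def regularEndLE (n : ℕ) (k : Type u) [Field k] (d : ℕ) :
    Subalgebra k (EndLE n k d → k) :=
  (aeval (R := k) fun (c : Fin n × (Fin n →₀ ℕ)) (f : EndLE n k d) =>
    (f.1.comp c.1).coeff c.2).range

/-- The Zariski topology on (the `k`-points of) the affine space `EndLE n k d`. -/
@[reducible]
noncomputable def zariski (n : ℕ) (k : Type u) [Field k] (d : ℕ) :
    TopologicalSpace (EndLE n k d) :=
  zeroLocusTopology (regularEndLE n k d)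

/-- The inductive limit topology (Shafarevich) on the set of endomorphisms: a subset is closed
if and only if its intersection with `EndLE n k d` is Zariski closed for each `d`. -/
@[reducible]
noncomputable def shafarevichEnd (n : ℕ) (k : Type u) [Field k] :
    TopologicalSpace (PolyEnd n k) :=
  ⨆ d : ℕ, TopologicalSpace.coinduced (Subtype.val : EndLE n k d → PolyEnd n k) (zariski n k d)

theorem isClosed_shafarevichEnd_iff (n : ℕ) (k : Type u) [Field k] (Z : Set (PolyEnd n k)) :
    IsClosed[shafarevichEnd n k] Z ↔
      ∀ d, IsClosed[zariski n k d] ((Subtype.val : EndLE n k d → PolyEnd n k) ⁻¹' Z) := by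
  unfold shafarevichEnd
  rw [isClosed_iSup_iff]
  exact forall_congr' fun d => isClosed_coinduced

/-- The algebra of regular functions on the ind-variety of endomorphisms: the functions whose
restriction to `EndLE n k d` is polynomial for each `d`. -/
noncomputable def regularEnd (n : ℕ) (k : Type u) [Field k] :
    Subalgebra k (PolyEnd n k → k) where
  carrier := {F | ∀ d, (fun f : EndLE n k d => F f.1) ∈ regularEndLE n k d}
  mul_mem' hF hG d := (regularEndLE n k d).mul_mem (hF d) (hG d)
  add_mem' hF hG d := (regularEndLE n k d).add_mem (hF d) (hG d)
  algebraMap_mem' r d := (regularEndLE n k d).algebraMap_mem r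

/-- The weaker topology (Kambayashi) on the set of endomorphisms: the closed subsets are the
common zero loci of sets of regular functions on the whole ind-variety. -/
@[reducible]
noncomputable def kambayashiEnd (n : ℕ) (k : Type u) [Field k] :
    TopologicalSpace (PolyEnd n k) :=
  zeroLocusTopology (regularEnd n k)

/-- The topology on the automorphisms of Jacobian `1` induced by the inductive limit topology. -/
@[reducible]
noncomputable def shafarevichSAut (n : ℕ) (k : Type u) [Field k] :
    TopologicalSpace (SAut n k) :=
  (shafarevichEnd n k).induced fun f => ((f : PolyAut n k) : PolyEnd n k)

/-- The topology on the automorphisms of Jacobian `1` induced by the weaker topology. -/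
@[reducible]
noncomputable def kambayashiSAut (n : ℕ) (k : Type u) [Field k] :
    TopologicalSpace (SAut n k) :=
  (kambayashiEnd n k).induced fun f => ((f : PolyAut n k) : PolyEnd n k)

/-- A group with a topology is simple in the topological sense (for ind-groups: simple as an
ind-group) if it is nontrivial and its only closed normal subgroups are the trivial one and the
whole group. -/
def IsTopologicallySimple (G : Type u) [Group G] (t : TopologicalSpace G) : Prop :=
  Nontrivial G ∧ ∀ N : Subgroup G, N.Normal → IsClosed[t] (N : Set G) → N = ⊥ ∨ N = ⊤

end AffineSpaceAut

/-! Write shear for an automorphism `xᵢ ↦ xᵢ + q` with `q` free of `xᵢ`. Tame automorphisms of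
Jacobian one are products of shears: affine and triangular maps are products of shears and diagonal
maps, the diagonal maps normalise the group of shears, and a diagonal map of determinant one is a
product of transvections (`mem_elementary_of_mem_tame`). It therefore suffices to show that a
nontrivial closed normal subgroup contains all shears.

Closedness enters only through limits: if infinitely many members of a polynomial one-parameter
family lie in a closed set, then all of them do (`mem_of_limit_of_isClosed`). A Kambayashi closed
set is Shafarevich closed, so one argument serves both topologies.

For `n ≥ 2`, take `f ≠ 1` in the subgroup. Its commutators with the translations along an axis form
a polynomial family through the identity. If some such family is not constant, conjugate it by
`x_{i₁} ↦ x_{i₁} + t^{-A} ℓ` while the parameter is rescaled as `t^B c`. For the right ratio `B / A`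
the poles cancel, and the limit at `t = 0` is a nontrivial shear
(`IsLimitClosedNormal.exists_shear_mem_of_family`). Otherwise `f` is a translation, and a commutator
with a linear shear is a translation along a single axis. Commutators of shears with translations
are shears by finite differences. Repeated differences reduce a shear to a translation
(`exists_translation_mem`), and differences of large powers of a variable, separated by
interpolation over the infinite field, produce every shear (`shear_mem_of_translation_mem`). For `n
= 1` in characteristic zero, `SAut` consists of translations, and the powers of one nontrivial
translation are already dense in this sense.

Simplicity for `n = 2` then follows from the theorem of Jung and van der Kulk, proved here in every
characteristic. Let `p = (p₀, p₁)` be the polynomial curve that `f` maps to the line `x₁ = 0`. If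
one of the two degrees divides the other, a shear lowers the degree sum; if one degree is zero, `f`
is visibly tame. Divisibility comes from Hasse derivatives along the coordinate `f₀`: they
annihilate `f₁`, whose top weighted form vanishes at the leading coefficients of `p` and so has a
factor `x₀^a - c x₁^b` with `a`, `b` coprime. The possible degrees of leading Taylor expansions are
closed under passing from `d` to `r` when `d.choose r ≠ 0` in the field. By Lucas their least
positive element, a multiple of `min a b`, divides the others, which forces `min a b = 1`
(`eq_one_or_eq_one_of_eval_component_eq_zero`). -/

namespace AffineSpaceAut

/-! ### Shears, linear and diagonal automorphisms. -/

section Basic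

variable {n : ℕ} {R : Type*} [CommRing R]

theorem PolyAut.ext_comp {f g : PolyAut n R}
    (h : ∀ i, (f : PolyEnd n R).comp i = (g : PolyEnd n R).comp i) : f = g :=
  Units.ext (PolyEnd.ext (funext h))

theorem comp_bind₁_inv (f : PolyAut n R) (i : Fin n) :
    bind₁ ((f⁻¹ : PolyAut n R) : PolyEnd n R).comp ((f : PolyEnd n R).comp i) = X i := by
  rw [← mul_comp, Units.mul_inv, one_comp]

theorem inv_bind₁_comp (f : PolyAut n R) (i : Fin n) :
    bind₁ (f : PolyEnd n R).comp (((f⁻¹ : PolyAut n R) : PolyEnd n R).comp i) = X i := by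
  rw [← mul_comp, Units.inv_mul, one_comp]

theorem aeval_congr_of_mem_supported {σ S : Type*} [CommRing S] [Algebra R S] {s : Set σ}
    {q : MvPolynomial σ R} (hq : q ∈ supported R s) {g g' : σ → S} (h : ∀ j ∈ s, g j = g' j) :
    aeval g q = aeval g' q :=
  eval₂Hom_congr' rfl (fun j hj _ => h j (mem_supported.1 hq hj)) rfl

theorem bind₁_congr_of_mem_supported {σ τ : Type*} {s : Set σ} {q : MvPolynomial σ R}
    (hq : q ∈ supported R s) {g g' : σ → MvPolynomial τ R} (h : ∀ j ∈ s, g j = g' j) :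
    bind₁ g q = bind₁ g' q :=
  aeval_congr_of_mem_supported hq h

theorem bind₁_eq_self_of_mem_supported {σ : Type*} {s : Set σ} {q : MvPolynomial σ R}
    (hq : q ∈ supported R s) {g : σ → MvPolynomial σ R} (h : ∀ j ∈ s, g j = X j) :
    bind₁ g q = q := by
  rw [bind₁_congr_of_mem_supported hq h, bind₁_X_left, AlgHom.id_apply]

/-- The endomorphism adding `q` to the `i`-th coordinate. -/
noncomputable def shearEnd (i : Fin n) (q : MvPolynomial (Fin n) R) : PolyEnd n R :=
  ⟨fun j => X j + Pi.single (M := fun _ => MvPolynomial (Fin n) R) i q j⟩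

theorem shearEnd_comp_self (i : Fin n) (q : MvPolynomial (Fin n) R) :
    (shearEnd i q).comp i = X i + q := by simp [shearEnd]

theorem shearEnd_comp_of_ne {i j : Fin n} (h : j ≠ i) (q : MvPolynomial (Fin n) R) :
    (shearEnd i q).comp j = X j := by simp [shearEnd, h]

theorem shearEnd_mul (i : Fin n) {p : MvPolynomial (Fin n) R} (hp : p ∈ supported R {i}ᶜ)
    (q : MvPolynomial (Fin n) R) : shearEnd i p * shearEnd i q = shearEnd i (p + q) := by
  ext1
  funext j
  rw [mul_comp]
  by_cases h : j = i
  · subst h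
    rw [shearEnd_comp_self, shearEnd_comp_self, map_add, bind₁_X_right, shearEnd_comp_self,
      bind₁_eq_self_of_mem_supported hp fun l hl => shearEnd_comp_of_ne hl q]
    ring
  · rw [shearEnd_comp_of_ne h, shearEnd_comp_of_ne h, bind₁_X_right, shearEnd_comp_of_ne h]

theorem shearEnd_zero (i : Fin n) : shearEnd i (0 : MvPolynomial (Fin n) R) = 1 := by
  ext1
  funext j
  simp [shearEnd, one_comp]

/-- The elementary automorphism `xᵢ ↦ xᵢ + q`, where `q` does not involve `xᵢ`. -/
noncomputable def shear (i : Fin n) (q : supported R ({i}ᶜ : Set (Fin n))) : PolyAut n R where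
  val := shearEnd i q
  inv := shearEnd i (-q : supported R ({i}ᶜ : Set (Fin n)))
  val_inv := by rw [shearEnd_mul i q.2]; simp [shearEnd_zero]
  inv_val := by rw [shearEnd_mul i (-q).2]; simp [shearEnd_zero]

theorem shear_val (i : Fin n) (q : supported R ({i}ᶜ : Set (Fin n))) :
    (shear i q : PolyEnd n R) = shearEnd i q := rfl

theorem shear_inv_val (i : Fin n) (q : supported R ({i}ᶜ : Set (Fin n))) :
    ((shear i q)⁻¹ : PolyAut n R).val = shearEnd i (-q : MvPolynomial (Fin n) R) := rfl

theorem shear_add (i : Fin n) (p q : supported R ({i}ᶜ : Set (Fin n))) :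
    shear i (p + q) = shear i p * shear i q :=
  Units.ext (shearEnd_mul i p.2 q).symm

theorem shear_zero (i : Fin n) : shear i (0 : supported R ({i}ᶜ : Set (Fin n))) = 1 :=
  Units.ext (shearEnd_zero i)

theorem pderiv_eq_zero_of_mem_supported {i : Fin n} {q : MvPolynomial (Fin n) R}
    (hq : q ∈ supported R {i}ᶜ) : pderiv i q = 0 :=
  pderiv_eq_zero_of_notMem_vars fun h => mem_supported.1 hq h rfl

theorem jac_shear (i : Fin n) (q : supported R ({i}ᶜ : Set (Fin n))) :
    jac (shear i q : PolyEnd n R) = 1 := by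
  classical
  have h : derivMatrix (shear i q : PolyEnd n R) =
      1 + Matrix.replicateCol Unit (Pi.single i (1 : MvPolynomial (Fin n) R)) *
        Matrix.replicateRow Unit fun j => pderiv j (q : MvPolynomial (Fin n) R) := by
    ext1 a b
    by_cases h : a = i
    · subst h
      simp [derivMatrix, shear_val, shearEnd, pderiv_X, Matrix.mul_apply, Matrix.one_apply,
        Pi.single_apply]
    · simp [derivMatrix, shear_val, shearEnd, pderiv_X, Matrix.mul_apply, Matrix.one_apply,
        Pi.single_apply, h]
  rw [jac, h, Matrix.det_one_add_replicateCol_mul_replicateRow]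
  simp [pderiv_eq_zero_of_mem_supported q.2]

theorem shear_mem_SAut (i : Fin n) (q : supported R ({i}ᶜ : Set (Fin n))) :
    shear i q ∈ SAut n R := jac_shear i q

theorem C_mem_supported {σ : Type*} (s : Set σ) (a : R) : (C a : MvPolynomial σ R) ∈ supported R s :=
  (supported R s).algebraMap_mem a

theorem X_mem_supported' {σ : Type*} {s : Set σ} {j : σ} (h : j ∈ s) :
    (X j : MvPolynomial σ R) ∈ supported R s :=
  Algebra.subset_adjoin ⟨j, h, rfl⟩

/-- The linear endomorphisms, as a monoid homomorphism. -/
noncomputable def linEnd (n : ℕ) (R : Type*) [CommRing R] :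
    Matrix (Fin n) (Fin n) R →* PolyEnd n R where
  toFun M := ⟨fun i => ∑ j, C (M i j) * X j⟩
  map_one' := by
    ext1
    funext i
    simp [one_comp, Matrix.one_apply]
  map_mul' M N := by
    ext1
    funext i
    simp only [mul_comp, map_sum, map_mul, bind₁_X_right, bind₁_C_right, Matrix.mul_apply,
      Finset.sum_mul, Finset.mul_sum]
    rw [Finset.sum_comm]
    simp only [mul_assoc]

theorem linEnd_comp (M : Matrix (Fin n) (Fin n) R) (i : Fin n) :
    (linEnd n R M).comp i = ∑ j, C (M i j) * X j := rfl

/-- The linear automorphisms, as a group homomorphism. -/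
noncomputable def lin (n : ℕ) (R : Type*) [CommRing R] :
    (Matrix (Fin n) (Fin n) R)ˣ →* PolyAut n R := Units.map (linEnd n R)

theorem lin_val (M : (Matrix (Fin n) (Fin n) R)ˣ) : (lin n R M : PolyEnd n R) = linEnd n R M := rfl

/-- The diagonal automorphisms, as a group homomorphism. -/
noncomputable def diag (n : ℕ) (R : Type*) [CommRing R] : (Fin n → Rˣ) →* PolyAut n R :=
  (lin n R).comp <| (Units.map (Matrix.diagonalRingHom (Fin n) R).toMonoidHom).comp
    (MulEquiv.piUnits (M := fun _ : Fin n => R)).symm.toMonoidHom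

theorem diag_comp (a : Fin n → Rˣ) (i : Fin n) :
    (diag n R a : PolyEnd n R).comp i = C (a i : R) * X i := by
  classical
  change ∑ j, C (Matrix.diagonal (fun i => (a i : R)) i j) * X j = _
  rw [Finset.sum_eq_single i]
  · simp
  · intro j _ hj
    simp [Matrix.diagonal_apply_ne' _ hj]
  · simp

theorem jac_diag (a : Fin n → Rˣ) : jac (diag n R a : PolyEnd n R) = C (∏ i, (a i : R)) := by
  classical
  have : derivMatrix (diag n R a : PolyEnd n R) = Matrix.diagonal fun i => C (a i : R) := by
    ext1 i j
    by_cases h : i = j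
    · subst h; simp [derivMatrix, diag_comp]
    · simp [derivMatrix, diag_comp, pderiv_X, h]
  rw [jac, this, Matrix.det_diagonal, map_prod]

end Basic

/-! ### The group generated by the shears. -/

section Elementary

variable {n : ℕ} {R : Type*} [CommRing R]

/-- The subgroup generated by the elementary automorphisms `xᵢ ↦ xᵢ + q`. -/
noncomputable def elementary (n : ℕ) (R : Type*) [CommRing R] : Subgroup (PolyAut n R) :=
  Subgroup.closure {f | ∃ i q, f = shear i q}

theorem shear_mem_elementary (i : Fin n) (q : supported R ({i}ᶜ : Set (Fin n))) :
    shear i q ∈ elementary n R := Subgroup.subset_closure ⟨i, q, rfl⟩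

theorem bind₁_mem_supported {σ τ : Type*} {s : Set σ} {t : Set τ} {q : MvPolynomial σ R}
    (hq : q ∈ supported R s) {g : σ → MvPolynomial τ R} (h : ∀ j ∈ s, g j ∈ supported R t) :
    bind₁ g q ∈ supported R t := by
  have : (supported R s).map (bind₁ g) ≤ supported R t := by
    rw [supported, AlgHom.map_adjoin, Algebra.adjoin_le_iff]
    rintro _ ⟨_, ⟨j, hj, rfl⟩, rfl⟩
    rw [bind₁_X_right]
    exact h j hj
  exact this ⟨q, hq, rfl⟩

theorem bind₁_diag_mem_supported {s : Set (Fin n)} (a : Fin n → Rˣ) {q : MvPolynomial (Fin n) R}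
    (hq : q ∈ supported R s) : bind₁ (diag n R a : PolyEnd n R).comp q ∈ supported R s :=
  bind₁_mem_supported hq fun j hj => by
    rw [diag_comp]
    exact (supported R s).mul_mem (C_mem_supported s _) (X_mem_supported' hj)

theorem bind₁_diag_inv (a : Fin n → Rˣ) (q : MvPolynomial (Fin n) R) :
    bind₁ (diag n R a : PolyEnd n R).comp (bind₁ (diag n R a⁻¹ : PolyEnd n R).comp q) = q := by
  rw [bind₁_bind₁]
  conv_rhs => rw [← AlgHom.id_apply (R := R) q, ← bind₁_X_left]
  congr 2
  funext i
  rw [diag_comp, map_mul, bind₁_X_right, bind₁_C_right, diag_comp, ← mul_assoc, ← C_mul]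
  simp

theorem diag_mul_shear (a : Fin n → Rˣ) (i : Fin n) (q : supported R ({i}ᶜ : Set (Fin n))) :
    diag n R a * shear i q = shear i ⟨C (a i : R) * bind₁ (diag n R a⁻¹ : PolyEnd n R).comp q.1,
      (supported R _).mul_mem (C_mem_supported _ _) (bind₁_diag_mem_supported _ q.2)⟩ *
        diag n R a := by
  refine PolyAut.ext_comp fun j => ?_
  simp only [Units.val_mul, mul_comp, shear_val]
  by_cases h : j = i
  · subst h
    rw [shearEnd_comp_self, diag_comp, map_mul, map_add, map_mul, bind₁_X_right, bind₁_X_right,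
      bind₁_diag_inv, shearEnd_comp_self, diag_comp, bind₁_C_right, bind₁_C_right]
    ring
  · rw [shearEnd_comp_of_ne h, diag_comp, map_mul, bind₁_X_right, bind₁_X_right,
      shearEnd_comp_of_ne h, diag_comp, bind₁_C_right]

theorem diag_mul_mul_diag_inv_mem_elementary (a : Fin n → Rˣ) {s : PolyAut n R}
    (hs : s ∈ elementary n R) : diag n R a * s * (diag n R a)⁻¹ ∈ elementary n R := by
  have : elementary n R ≤ (elementary n R).comap (MulAut.conj (diag n R a)).toMonoidHom := by
    refine (Subgroup.closure_le _).2 ?_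
    rintro _ ⟨i, q, rfl⟩
    change diag n R a * shear i q * (diag n R a)⁻¹ ∈ elementary n R
    rw [diag_mul_shear, mul_inv_cancel_right]
    exact shear_mem_elementary _ _
  exact this hs

theorem range_diag_le_normalizer_elementary :
    (diag n R).range ≤ Subgroup.normalizer (elementary n R : Set (PolyAut n R)) := by
  rintro _ ⟨a, rfl⟩
  rw [Subgroup.mem_normalizer_iff]
  refine fun s => ⟨diag_mul_mul_diag_inv_mem_elementary a, fun h => ?_⟩
  have := diag_mul_mul_diag_inv_mem_elementary a⁻¹ h
  rwa [map_inv, inv_inv, ← mul_assoc, ← mul_assoc, inv_mul_cancel, one_mul,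
    inv_mul_cancel_right] at this

/-- In `SL₂` the matrix with diagonal `u`, `u⁻¹` is a product of four transvections; the same
factorisation works in the coordinates `i`, `j`. -/
theorem diag_mulSingle_mem_elementary {i j : Fin n} (h : i ≠ j) (u : Rˣ) :
    diag n R (Pi.mulSingle i u * Pi.mulSingle j u⁻¹) ∈ elementary n R := by
  have hX : ∀ {i j : Fin n}, j ≠ i → ∀ c : R,
      C c * X j ∈ supported R ({i}ᶜ : Set (Fin n)) := fun hij c =>
    (supported R _).mul_mem (C_mem_supported _ _) (X_mem_supported' hij)
  have key : diag n R (Pi.mulSingle i u * Pi.mulSingle j u⁻¹) =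
      shear j ⟨_, hX h ((u⁻¹ : Rˣ) - 1 : R)⟩ * shear i ⟨_, hX h.symm 1⟩ *
        shear j ⟨_, hX h (u - 1 : R)⟩ * shear i ⟨_, hX h.symm (-(u⁻¹ : Rˣ) : R)⟩ := by
    have hu : (C (u : R) * C ((u⁻¹ : Rˣ) : R) : MvPolynomial (Fin n) R) = 1 := by
      rw [← C_mul, Units.mul_inv, C_1]
    refine PolyAut.ext_comp fun l => ?_
    simp only [Units.val_mul, mul_comp, shear_val, diag_comp]
    by_cases hi : l = i
    · subst hi
      simp only [shearEnd_comp_self, shearEnd_comp_of_ne h, shearEnd_comp_of_ne h.symm, map_add,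
        map_mul, bind₁_X_right, bind₁_C_right, Pi.mul_apply, Pi.mulSingle_eq_same, ne_eq, h,
        not_false_eq_true, Pi.mulSingle_eq_of_ne, mul_one, map_sub, map_neg, map_one]
      linear_combination (X j) * hu
    by_cases hj : l = j
    · subst hj
      simp only [shearEnd_comp_self, shearEnd_comp_of_ne h, shearEnd_comp_of_ne h.symm, map_add,
        map_mul, bind₁_X_right, bind₁_C_right, Pi.mul_apply, Pi.mulSingle_eq_same, ne_eq, h.symm,
        not_false_eq_true, Pi.mulSingle_eq_of_ne, one_mul, map_sub, map_neg, map_one]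
      linear_combination (X l * C ((u⁻¹ : Rˣ) : R) - X i) * hu
    · simp [shearEnd_comp_of_ne hi, shearEnd_comp_of_ne hj, hi, hj]
  rw [key]
  have := fun i q => shear_mem_elementary (n := n) (R := R) i q
  exact mul_mem (mul_mem (mul_mem (this _ _) (this _ _)) (this _ _)) (this _ _)

theorem diag_mem_elementary_of_prod_eq_one (a : Fin n → Rˣ) (ha : ∏ i, a i = 1) :
    diag n R a ∈ elementary n R := by
  cases n with
  | zero => rw [Subsingleton.elim a 1, map_one]; exact one_mem _
  | succ n =>
    -- Each entry is compensated at the index `0`; the compensations multiply to one by `ha`.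
    have h : a = ∏ i, (Pi.mulSingle i (a i) * Pi.mulSingle 0 (a i)⁻¹) := by
      rw [Finset.prod_mul_distrib, Finset.univ_prod_mulSingle]
      have : ∏ i, (Pi.mulSingle 0 (a i)⁻¹ : Fin (n + 1) → Rˣ) =
          Pi.mulSingle 0 (∏ i, (a i)⁻¹) :=
        (map_prod (MonoidHom.mulSingle (fun _ : Fin (n + 1) => Rˣ) 0) _ _).symm
      rw [this, Finset.prod_inv_distrib, ha, inv_one, Pi.mulSingle_one, mul_one]
    have hm : ∏ i, (Pi.mulSingle i (a i) * Pi.mulSingle 0 (a i)⁻¹ : Fin (n + 1) → Rˣ) ∈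
        (elementary (n + 1) R).comap (diag (n + 1) R) := by
      refine Subgroup.prod_mem _ fun i _ => ?_
      rw [Subgroup.mem_comap]
      by_cases hi : i = 0
      · subst hi
        rw [← Pi.mulSingle_mul, mul_inv_cancel, Pi.mulSingle_one, map_one]
        exact one_mem _
      · exact diag_mulSingle_mem_elementary hi _
    rw [h]
    exact hm

/-- The coordinates are treated one at a time in increasing order. The shear in coordinate `m` is
put on the right, where it substitutes only for `x_m`, a variable absent from the `b i` already
installed. -/
theorem exists_mem_elementary_comp_eq (b : Fin n → MvPolynomial (Fin n) R)
    (hb : ∀ i, b i ∈ supported R {j : Fin n | j < i}) :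
    ∃ s ∈ elementary n R, ∀ i, (s : PolyEnd n R).comp i = X i + b i := by
  have hstep : ∀ m ≤ n, ∃ s ∈ elementary n R,
      ∀ i, (s : PolyEnd n R).comp i = X i + if (i : ℕ) < m then b i else 0 := by
    intro m
    induction m with
    | zero => exact fun _ => ⟨1, one_mem _, fun i => by simp [one_comp]⟩
    | succ m ih =>
      intro hm
      obtain ⟨s, hs, hsc⟩ := ih (by omega)
      let i₀ : Fin n := ⟨m, by omega⟩
      refine ⟨s * shear i₀ ⟨b i₀, supported_mono (fun j (hj : j < i₀) => hj.ne) (hb i₀)⟩,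
        mul_mem hs (shear_mem_elementary _ _), fun i => ?_⟩
      rw [Units.val_mul, mul_comp, hsc, map_add, bind₁_X_right, shear_val]
      rcases lt_trichotomy (i : ℕ) m with h | h | h
      · rw [if_pos h, if_pos (by omega), shearEnd_comp_of_ne (by rintro rfl; simp [i₀] at h),
          bind₁_eq_self_of_mem_supported (hb i)]
        intro j (hj : (j : ℕ) < i)
        exact shearEnd_comp_of_ne (by rintro rfl; simp [i₀] at hj; omega) _
      · obtain rfl : i = i₀ := Fin.ext h
        rw [if_neg (by omega), if_pos (by omega), shearEnd_comp_self, map_zero, add_zero]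
      · rw [if_neg (by omega), if_neg (by omega),
          shearEnd_comp_of_ne (by rintro rfl; simp [i₀] at h), map_zero]
  obtain ⟨s, hs, h⟩ := hstep n le_rfl
  exact ⟨s, hs, fun i => by rw [h, if_pos i.2]⟩

end Elementary

/-! ### Tame automorphisms of Jacobian one are products of shears. -/

section Tame

variable {n : ℕ} {k : Type*} [Field k]

theorem triangularAuts_subset : triangularAuts n k ⊆ ↑(elementary n k ⊔ (diag n k).range) := by
  rintro f ⟨a, b, hb, hf⟩
  obtain ⟨s, hs, hsc⟩ := exists_mem_elementary_comp_eq
    (fun i => bind₁ (diag n k a⁻¹ : PolyEnd n k).comp (b i))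
    fun i => bind₁_diag_mem_supported _ (hb i)
  have : f = s * diag n k a := by
    refine PolyAut.ext_comp fun i => ?_
    rw [hf, Units.val_mul, mul_comp, hsc, map_add, bind₁_diag_inv, bind₁_X_right, diag_comp]
  rw [this]
  exact mul_mem (Subgroup.mem_sup_left hs) (Subgroup.mem_sup_right ⟨a, rfl⟩)

/-- Gaussian elimination: an invertible matrix is built from transvections and an invertible
diagonal matrix. -/
theorem lin_mem_sup (M : (Matrix (Fin n) (Fin n) k)ˣ) :
    lin n k M ∈ elementary n k ⊔ (diag n k).range := by
  have key : ∀ M : Matrix (Fin n) (Fin n) k, M.det ≠ 0 →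
      ∃ g ∈ elementary n k ⊔ (diag n k).range, (g : PolyEnd n k) = linEnd n k M := by
    intro M hM
    refine Matrix.diagonal_transvection_induction_of_det_ne_zero
      (fun M => ∃ g ∈ elementary n k ⊔ (diag n k).range, (g : PolyEnd n k) = linEnd n k M)
      M hM ?_ ?_ ?_
    · intro D hD
      rw [Matrix.det_diagonal, Finset.prod_ne_zero_iff] at hD
      refine ⟨diag n k fun i => Units.mk0 (D i) (hD i (Finset.mem_univ i)),
        Subgroup.mem_sup_right ⟨_, rfl⟩, rfl⟩
    · rintro ⟨i, j, hij, c⟩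
      refine ⟨shear i ⟨C c * X j, (supported k _).mul_mem (C_mem_supported _ _)
        (X_mem_supported' hij.symm)⟩, Subgroup.mem_sup_left (shear_mem_elementary _ _), ?_⟩
      ext1
      funext l
      rw [linEnd_comp, shear_val]
      simp only [Matrix.TransvectionStruct.toMatrix_mk, Matrix.transvection, Matrix.add_apply,
        map_add, add_mul, Finset.sum_add_distrib]
      by_cases h : l = i
      · subst h
        simp [shearEnd_comp_self, Matrix.one_apply, Matrix.single_apply, apply_ite C, ite_mul]
      · simp [shearEnd_comp_of_ne h, Matrix.one_apply, Ne.symm h]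
    · rintro A B _ _ ⟨g, hg, hgA⟩ ⟨h, hh, hhB⟩
      exact ⟨g * h, mul_mem hg hh, by rw [Units.val_mul, hgA, hhB, map_mul]⟩
  obtain ⟨g, hg, h⟩ := key M ((Matrix.isUnit_iff_isUnit_det _).1 M.isUnit).ne_zero
  rwa [← show g = lin n k M from Units.ext h]

theorem affineAuts_subset : affineAuts n k ⊆ ↑(elementary n k ⊔ (diag n k).range) := by
  rintro f ⟨M, v, hM, hf⟩
  obtain ⟨s, hs, hsc⟩ := exists_mem_elementary_comp_eq (fun i => C (v i))
    fun i => C_mem_supported (R := k) _ _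
  obtain ⟨U, rfl⟩ := (Matrix.isUnit_iff_isUnit_det M).2 hM
  have : f = s * lin n k U := by
    refine PolyAut.ext_comp fun i => ?_
    rw [hf, Units.val_mul, mul_comp, hsc, map_add, bind₁_X_right, lin_val, linEnd_comp,
      bind₁_C_right]
  rw [this]
  exact mul_mem (Subgroup.mem_sup_left hs) (lin_mem_sup U)

/-- Because the diagonal maps normalise `elementary`, the join of the two groups is the set of
products `s * diag a`. Shears have Jacobian one, so the Jacobian of such a product is `∏ a i`. -/
theorem mem_elementary_of_mem_tame {f : PolyAut n k} (hf : f ∈ Tame n k) (hj : f ∈ SAut n k) :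
    f ∈ elementary n k := by
  have h : f ∈ (↑(elementary n k ⊔ (diag n k).range) : Set (PolyAut n k)) :=
    (Subgroup.closure_le _).2 (Set.union_subset affineAuts_subset triangularAuts_subset) hf
  rw [Subgroup.coe_mul_of_right_le_normalizer_left _ _ range_diag_le_normalizer_elementary] at h
  obtain ⟨s, hs, _, ⟨a, rfl⟩, rfl⟩ := h
  have hsS : s ∈ SAut n k := by
    refine (Subgroup.closure_le (SAut n k)).2 ?_ hs
    rintro _ ⟨i, q, rfl⟩
    exact shear_mem_SAut i q
  have ha : jac (diag n k a : PolyEnd n k) = 1 := (Subgroup.mul_mem_cancel_left _ hsS).1 hj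
  rw [jac_diag, ← C_1] at ha
  refine mul_mem hs (diag_mem_elementary_of_prod_eq_one a (Units.ext ?_))
  rw [Units.coe_prod, C_injective _ _ ha, Units.val_one]

end Tame

/-! ### One-parameter polynomial families. -/

section Families

variable {σ : Type*} {k : Type*} [Field k]

/-- The value at the parameter `t` of a family of polynomials: the variable `none` is the
parameter. -/
noncomputable def spec (t : k) : MvPolynomial (Option σ) k →ₐ[k] MvPolynomial σ k :=
  aeval fun o => o.elim (C t) X

@[simp] theorem spec_X_none (t : k) : spec (σ := σ) t (X none) = C t := by simp [spec]

@[simp] theorem spec_X_some (t : k) (i : σ) : spec t (X (some i)) = X i := by simp [spec]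

@[simp] theorem spec_C (t a : k) : spec (σ := σ) t (C a) = C a := by simp [spec]

theorem exists_coeff_spec_eq_eval (p : MvPolynomial (Option σ) k) (m : σ →₀ ℕ) :
    ∃ q : Polynomial k, ∀ t, (spec t p).coeff m = q.eval t := by
  classical
  induction p using MvPolynomial.induction_on generalizing m with
  | C a => exact ⟨Polynomial.C (coeff m (C a)), fun t => by simp⟩
  | add p q hp hq =>
    obtain ⟨q₁, h₁⟩ := hp m
    obtain ⟨q₂, h₂⟩ := hq m
    exact ⟨q₁ + q₂, fun t => by simp [h₁, h₂]⟩
  | mul_X p o hp =>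
    cases o with
    | none =>
      obtain ⟨q, h⟩ := hp m
      exact ⟨q * Polynomial.X, fun t => by simp [mul_comm _ (C t), coeff_C_mul, h, mul_comm]⟩
    | some i =>
      by_cases hi : i ∈ m.support
      · obtain ⟨q, h⟩ := hp (m - Finsupp.single i 1)
        exact ⟨q, fun t => by rw [map_mul, spec_X_some, coeff_mul_X', if_pos hi, h]⟩
      · exact ⟨0, fun t => by rw [map_mul, spec_X_some, coeff_mul_X', if_neg hi]; simp⟩

theorem exists_totalDegree_spec_le (p : MvPolynomial (Option σ) k) :
    ∃ d, ∀ t, (spec t p).totalDegree ≤ d := by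
  induction p using MvPolynomial.induction_on with
  | C a => exact ⟨0, fun t => by simp⟩
  | add p q hp hq =>
    obtain ⟨d₁, h₁⟩ := hp
    obtain ⟨d₂, h₂⟩ := hq
    refine ⟨max d₁ d₂, fun t => ?_⟩
    rw [map_add]
    exact (totalDegree_add _ _).trans (max_le_max (h₁ t) (h₂ t))
  | mul_X p o hp =>
    obtain ⟨d, h⟩ := hp
    refine ⟨d + 1, fun t => ?_⟩
    rw [map_mul]
    refine (totalDegree_mul _ _).trans (add_le_add (h t) ?_)
    cases o <;> simp

theorem spec_bind₁ {τ : Type*} (t : k) (g : τ → MvPolynomial (Option σ) k) (p : MvPolynomial τ k) :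
    spec t (bind₁ g p) = bind₁ (fun j => spec t (g j)) p := by
  induction p using MvPolynomial.induction_on with
  | C a => simp
  | add p q hp hq => simp [hp, hq]
  | mul_X p i hp => simp [hp]

end Families

/-! ### Limits of families in closed subsets and closed normal subgroups. -/

section Closed

universe u

variable {n : ℕ} {k : Type u} [Field k]

theorem exists_eq_eval_of_mem_regularEndLE {d : ℕ} {F : EndLE n k d → k}
    (hF : F ∈ regularEndLE n k d) (c : k → EndLE n k d)
    (hc : ∀ i m, ∃ q : Polynomial k, ∀ t, ((c t).1.comp i).coeff m = q.eval t) :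
    ∃ q : Polynomial k, ∀ t, F (c t) = q.eval t := by
  obtain ⟨G, rfl⟩ := hF
  induction G using MvPolynomial.induction_on with
  | C a => exact ⟨Polynomial.C a, fun t => by simp⟩
  | add p q hp hq =>
    obtain ⟨q₁, h₁⟩ := hp
    obtain ⟨q₂, h₂⟩ := hq
    exact ⟨q₁ + q₂, fun t => by
      rw [Polynomial.eval_add, ← h₁, ← h₂]
      simp⟩
  | mul_X p o hp =>
    obtain ⟨q₁, h₁⟩ := hp
    obtain ⟨q₂, h₂⟩ := hc o.1 o.2
    exact ⟨q₁ * q₂, fun t => by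
      rw [Polynomial.eval_mul, ← h₁, ← h₂]
      simp⟩

/-- A subgroup of automorphisms of Jacobian `1`, normalised by all of these, which contains
the limits in `SAut n k` of the polynomial one-parameter families of its elements. -/
structure IsLimitClosedNormal (P : Subgroup (PolyAut n k)) : Prop where
  le_SAut : P ≤ SAut n k
  conj_mem : ∀ g ∈ SAut n k, ∀ f ∈ P, g * f * g⁻¹ ∈ P
  limit_mem : ∀ H : Fin n → MvPolynomial (Option (Fin n)) k,
    {t : k | ∃ f ∈ P, ∀ i, (f : PolyEnd n k).comp i = spec t (H i)}.Infinite →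
    ∀ f ∈ SAut n k, ∀ t₀, (∀ i, (f : PolyEnd n k).comp i = spec t₀ (H i)) → f ∈ P

/-- The whole family has bounded degree, hence lives in one `EndLE n k d`. A defining equation of
`Z` there becomes a polynomial in `t` with infinitely many roots, so it vanishes identically. -/
theorem mem_of_limit_of_isClosed {Z : Set (PolyEnd n k)} (hZ : IsClosed[shafarevichEnd n k] Z)
    (H : Fin n → MvPolynomial (Option (Fin n)) k)
    (hH : {t : k | (⟨fun i => spec t (H i)⟩ : PolyEnd n k) ∈ Z}.Infinite) (t₀ : k) :
    (⟨fun i => spec t₀ (H i)⟩ : PolyEnd n k) ∈ Z := by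
  rw [isClosed_shafarevichEnd_iff] at hZ
  choose dg hdg using fun i => exists_totalDegree_spec_le (H i)
  have hd : ∀ t i, (spec t (H i)).totalDegree ≤ Finset.univ.sup dg := fun t i =>
    (hdg i t).trans (Finset.le_sup (f := dg) (Finset.mem_univ i))
  let c : k → EndLE n k (Finset.univ.sup dg) := fun t => ⟨⟨fun i => spec t (H i)⟩, hd t⟩
  obtain ⟨S, hS, hSZ⟩ := (isClosed_zeroLocusTopology_iff _ _).1 (hZ (Finset.univ.sup dg))
  have hmem : ∀ t, (⟨fun i => spec t (H i)⟩ : PolyEnd n k) ∈ Z ↔ ∀ F ∈ S, F (c t) = 0 :=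
    fun t => Set.ext_iff.1 hSZ (c t)
  rw [hmem]
  intro F hF
  obtain ⟨q, hq⟩ := exists_eq_eval_of_mem_regularEndLE (hS hF) c
    fun i m => exists_coeff_spec_eq_eval (H i) m
  have : q = 0 := by
    refine Polynomial.eq_zero_of_infinite_isRoot q (hH.mono fun t ht => ?_)
    rw [Set.mem_ofPred_eq, Polynomial.IsRoot.def, ← hq]
    exact (hmem t).1 ht F hF
  rw [hq, this, Polynomial.eval_zero]

theorem isLimitClosedNormal_map_subtype {N : Subgroup (SAut n k)} (hN : N.Normal)
    (hcl : IsClosed[shafarevichSAut n k] (N : Set (SAut n k))) :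
    IsLimitClosedNormal (N.map (SAut n k).subtype) := by
  obtain ⟨Z, hZ, hZN⟩ := (@isClosed_induced_iff _ _ (shafarevichEnd n k) _ _).1 hcl
  have hmem : ∀ g : SAut n k, ((g : PolyAut n k) : PolyEnd n k) ∈ Z ↔ g ∈ N := fun g => by
    rw [← SetLike.mem_coe, ← hZN, Set.mem_preimage]
  refine ⟨?_, ?_, ?_⟩
  · rintro _ ⟨f, -, rfl⟩
    exact f.2
  · rintro g hg _ ⟨f, hf, rfl⟩
    exact Subgroup.mem_map.2 ⟨_, hN.conj_mem f hf ⟨g, hg⟩, by simp⟩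
  · intro H hH f hf t₀ hft
    have hval : ∀ (g : PolyAut n k) t, (∀ i, (g : PolyEnd n k).comp i = spec t (H i)) →
        (g : PolyEnd n k) = ⟨fun i => spec t (H i)⟩ := fun g t h => PolyEnd.ext (funext h)
    refine ⟨⟨f, hf⟩, (hmem ⟨f, hf⟩).1 ?_, rfl⟩
    rw [Subgroup.coe_mk, hval f t₀ hft]
    refine mem_of_limit_of_isClosed hZ H (hH.mono ?_) t₀
    rintro t ⟨_, ⟨g, hg, rfl⟩, hgt⟩
    rw [Set.mem_ofPred_eq, ← hval _ t hgt]
    exact (hmem g).2 hg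

theorem isClosed_shafarevichSAut_of_kambayashiSAut {N : Set (SAut n k)}
    (hN : IsClosed[kambayashiSAut n k] N) : IsClosed[shafarevichSAut n k] N := by
  obtain ⟨Z, hZ, hZN⟩ := (@isClosed_induced_iff _ _ (kambayashiEnd n k) _ _).1 hN
  refine (@isClosed_induced_iff _ _ (shafarevichEnd n k) _ _).2 ⟨Z, ?_, hZN⟩
  obtain ⟨S, hS, rfl⟩ := (isClosed_zeroLocusTopology_iff _ _).1 hZ
  rw [isClosed_shafarevichEnd_iff]
  refine fun d => (isClosed_zeroLocusTopology_iff _ _).2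
    ⟨(fun F f => F f.1) '' S, ?_, ?_⟩
  · rintro _ ⟨F, hF, rfl⟩
    exact hS hF d
  · ext f
    simp

end Closed

/-! ### Binomial coefficients in a field, and interpolation over an infinite field. -/

section Numbers

variable {K : Type*} [Field K]

/-- Lucas: the lowest `N` base-`p` digits of the two numbers agree, and the remaining digits of `n %
p ^ N` vanish, so every factor is one. -/
theorem cast_choose_mod_pow (p : ℕ) [Fact p.Prime] [CharP K p] (n N : ℕ) :
    (n.choose (n % p ^ N) : K) = 1 := by
  have hp : 0 < p := (Fact.out : p.Prime).pos
  have h := Choose.choose_modEq_choose_mul_prod_range_choose (n := n) (k := n % p ^ N) (p := p) N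
  have hdig : ∀ i ∈ Finset.range N, (n / p ^ i % p).choose (n % p ^ N / p ^ i % p) = 1 := by
    intro i hi
    have hi : N = i + 1 + (N - i - 1) := by have := Finset.mem_range.1 hi; omega
    have : n / p ^ i % p = n % p ^ N / p ^ i % p := by
      conv_lhs => rw [← Nat.mod_add_div n (p ^ N)]
      conv_lhs => rw [show p ^ N * (n / p ^ N) = p ^ i * (p * (p ^ (N - i - 1) * (n / p ^ N))) by
        generalize n / p ^ N = x
        conv_lhs => rw [hi]
        ring]
      rw [Nat.add_mul_div_left _ _ (by positivity), Nat.add_mul_mod_self_left]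
    rw [this, Nat.choose_self]
  rw [Finset.prod_congr rfl (g := fun _ => 1) (by exact_mod_cast hdig),
    Nat.div_eq_of_lt (Nat.mod_lt _ (by positivity)), Nat.choose_zero_right] at h
  have h' := (CharP.intCast_eq_intCast K p).2 h
  simpa using h'

/-- Lucas: the lowest `N` digits of `p ^ N` are zero, and what remains is `l.choose 1`. -/
theorem cast_choose_pow_mul (p : ℕ) [Fact p.Prime] [CharP K p] (N l : ℕ) :
    ((p ^ N * l).choose (p ^ N) : K) = l := by
  have hp : 0 < p := (Fact.out : p.Prime).pos
  have h := Choose.choose_modEq_choose_mul_prod_range_choose (n := p ^ N * l) (k := p ^ N)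
    (p := p) N
  have hdig : ∀ i ∈ Finset.range N, (p ^ N * l / p ^ i % p).choose (p ^ N / p ^ i % p) = 1 := by
    intro i hi
    have hi : N = i + 1 + (N - i - 1) := by have := Finset.mem_range.1 hi; omega
    have : p ^ N / p ^ i % p = 0 := by
      conv_lhs => rw [show p ^ N = p ^ i * (p * (p ^ (N - i - 1))) by
        conv_lhs => rw [hi]
        ring]
      rw [Nat.mul_div_cancel_left _ (by positivity), Nat.mul_mod_right]
    rw [this, Nat.choose_zero_right]
  rw [Finset.prod_congr rfl (g := fun _ => 1) (by exact_mod_cast hdig),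
    Nat.mul_div_cancel_left _ (by positivity), Nat.div_self (by positivity),
    Nat.choose_one_right] at h
  have h' := (CharP.intCast_eq_intCast K p).2 h
  simpa using h'

theorem exists_lt_cast_choose_ne_zero (K : Type*) [Field K] (e : ℕ) :
    ∃ d, e < d ∧ (d.choose e : K) ≠ 0 := by
  obtain ⟨p, hp⟩ := CharP.exists K
  rcases CharP.char_is_prime_or_zero K p with h | rfl
  · have : Fact p.Prime := ⟨h⟩
    have he : e < p ^ e := Nat.lt_pow_self h.one_lt
    -- Since `e < p ^ e`, reducing `e + p ^ e` modulo `p ^ e` gives back `e`.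
    refine ⟨e + p ^ e, by omega, ?_⟩
    have := cast_choose_mod_pow (K := K) p (e + p ^ e) e
    rw [Nat.add_mod_right, Nat.mod_eq_of_lt he] at this
    rw [this]
    exact one_ne_zero
  · have := CharP.charP_to_charZero K
    refine ⟨e + 1, by omega, ?_⟩
    rw [Nat.choose_succ_self_right]
    exact_mod_cast e.succ_ne_zero

/-- A functional on `V ⧸ W` turns the hypothesis into a polynomial in `a` that vanishes on an
infinite field; as the exponents are distinct, each of its coefficients is the functional at a
single `w l`. -/
theorem Submodule.mem_of_forall_sum_pow_smul_mem [Infinite K] {V ι : Type*} [AddCommGroup V]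
    [Module K V] (W : Submodule K V) (s : Finset ι) (w : ι → V) (e : ι → ℕ) (he : Set.InjOn e s)
    (h : ∀ a : K, ∑ l ∈ s, a ^ e l • w l ∈ W) {l : ι} (hl : l ∈ s) : w l ∈ W := by
  rw [← Submodule.Quotient.mk_eq_zero, ← Module.forall_dual_apply_eq_zero_iff K]
  intro φ
  have hq : ∑ l ∈ s, Polynomial.monomial (e l) (φ (W.mkQ (w l))) = 0 := by
    refine Polynomial.funext fun a => ?_
    have := congrArg φ ((Submodule.Quotient.mk_eq_zero W).2 (h a))
    rw [← Submodule.mkQ_apply, map_sum, map_sum, map_zero] at this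
    rw [Polynomial.eval_finsetSum, Polynomial.eval_zero, ← this]
    refine Finset.sum_congr rfl fun l _ => ?_
    rw [Polynomial.eval_monomial, map_smul, map_smul, smul_eq_mul, mul_comm]
  have := congrArg (fun p => p.coeff (e l)) hq
  simp only [Polynomial.finsetSum_coeff, Polynomial.coeff_monomial, Polynomial.coeff_zero] at this
  rwa [Finset.sum_eq_single l (fun b hb hbl => if_neg fun h => hbl (he hb hl h))
    (fun h => absurd hl h), if_pos rfl] at this

theorem apply_eq_of_forall_apply_update_eq {ι X Y : Type*} [Finite ι] [DecidableEq ι]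
    (F : (ι → X) → Y) (hF : ∀ x i b, F (Function.update x i b) = F x) (x y : ι → X) :
    F x = F y := by
  classical
  cases nonempty_fintype ι
  have : ∀ s : Finset ι, F (s.piecewise x y) = F y := by
    intro s
    induction s using Finset.induction_on with
    | empty => rw [Finset.piecewise_empty]
    | insert j s _ ih => rw [Finset.piecewise_insert, hF, ih]
  rw [← this Finset.univ, Finset.piecewise_univ]

end Numbers

/-! ### Finite differences as commutators with translations. -/

section Shift

variable {n : ℕ} {R : Type*} [CommRing R]

/-- The polynomial obtained from `q` by adding `a` to the `j`-th variable. -/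
noncomputable def shift (j : Fin n) (a : R) :
    MvPolynomial (Fin n) R →ₐ[R] MvPolynomial (Fin n) R :=
  bind₁ (shearEnd j (C a)).comp

theorem shift_X_self (j : Fin n) (a : R) : shift j a (X j) = X j + C a := by
  rw [shift, bind₁_X_right, shearEnd_comp_self]

theorem shift_X_of_ne {i j : Fin n} (h : i ≠ j) (a : R) : shift j a (X i) = X i := by
  rw [shift, bind₁_X_right, shearEnd_comp_of_ne h]

theorem shift_C (j : Fin n) (a b : R) : shift j a (C b) = C b := bind₁_C_right _ _

theorem shift_mem_supported {i j : Fin n} (a : R) {q : MvPolynomial (Fin n) R}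
    (hq : q ∈ supported R {i}ᶜ) : shift j a q ∈ supported R {i}ᶜ := by
  refine bind₁_mem_supported hq fun l hl => ?_
  by_cases h : l = j
  · subst h
    rw [shearEnd_comp_self]
    exact (supported R _).add_mem (X_mem_supported' hl) (C_mem_supported _ _)
  · rw [shearEnd_comp_of_ne h]
    exact X_mem_supported' hl

theorem shift_eq_self_of_mem_supported {j : Fin n} (a : R) {q : MvPolynomial (Fin n) R}
    (hq : q ∈ supported R {j}ᶜ) : shift j a q = q :=
  bind₁_eq_self_of_mem_supported hq fun _ hl => shearEnd_comp_of_ne hl _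

theorem eval_shift (j : Fin n) (a : R) (x : Fin n → R) (q : MvPolynomial (Fin n) R) :
    eval x (shift j a q) = eval (Function.update x j (x j + a)) q := by
  induction q using MvPolynomial.induction_on with
  | C b => rw [shift_C, eval_C, eval_C]
  | add p q hp hq => simp [hp, hq]
  | mul_X p i hp =>
    rw [map_mul, map_mul, map_mul, hp]
    by_cases h : i = j
    · subst h
      simp [shift_X_self]
    · simp [shift_X_of_ne h, h]

/-- The second conjunct makes up for the truncated `d - 1` at `d = 0`; the induction on monomials
needs it when it passes from degree `0` to degree `1`. -/
theorem totalDegree_shift_sub_self (j : Fin n) (a : R) {d : ℕ} (q : MvPolynomial (Fin n) R)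
    (hq : q.totalDegree ≤ d) :
    (shift j a q - q).totalDegree ≤ d - 1 ∧ (d = 0 → shift j a q = q) := by
  have hmon : ∀ (d : ℕ) (m : Fin n →₀ ℕ) (c : R), m.degree ≤ d →
      (shift j a (monomial m c) - monomial m c).totalDegree ≤ d - 1 ∧
        (d = 0 → shift j a (monomial m c) = monomial m c) := by
    intro d
    induction d with
    | zero =>
      intro m c hm
      obtain rfl : m = 0 := (Finsupp.degree_eq_zero_iff m).1 (by omega)
      rw [← C_apply, shift_C]
      simp
    | succ d ih =>
      intro m c hm
      refine ⟨?_, by simp⟩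
      by_cases h0 : m = 0
      · subst h0
        rw [← C_apply, shift_C]
        simp
      obtain ⟨l, hl⟩ := Finsupp.ne_iff.1 h0
      have hle : Finsupp.single l 1 ≤ m := by
        rw [Finsupp.single_le_iff]
        exact Nat.one_le_iff_ne_zero.2 hl
      have hm' : m = (m - Finsupp.single l 1) + Finsupp.single l 1 := (tsub_add_cancel_of_le hle).symm
      set m' := m - Finsupp.single l 1
      have hdeg : m'.degree ≤ d := by
        rw [hm', map_add, Finsupp.degree_single] at hm
        omega
      obtain ⟨h1, h2⟩ := ih m' c hdeg
      have hmm : monomial m c = monomial m' c * X l := by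
        rw [X, monomial_mul, mul_one, ← hm']
      have htd : (monomial m' c).totalDegree ≤ d := (totalDegree_monomial_le _ _).trans hdeg
      have key : ∃ b : R, shift j a (X l) = X l + C b := by
        by_cases h : l = j
        · subst h
          exact ⟨a, shift_X_self l a⟩
        · exact ⟨0, by rw [shift_X_of_ne h]; simp⟩
      obtain ⟨b, hb⟩ := key
      have hXb : (X l + C b : MvPolynomial (Fin n) R).totalDegree ≤ 1 :=
        (totalDegree_add _ _).trans (max_le ((totalDegree_monomial_le _ _).trans (by simp))
          (by simp))
      rw [hmm, map_mul, hb, show shift j a (monomial m' c) * (X l + C b) - monomial m' c * X l =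
        (shift j a (monomial m' c) - monomial m' c) * (X l + C b) + monomial m' c * C b by ring]
      refine (totalDegree_add _ _).trans (max_le ?_ ?_)
      · rcases Nat.eq_zero_or_pos d with hd | hd
        · rw [h2 hd]
          simp
        · exact (totalDegree_mul _ _).trans (by omega)
      · exact (totalDegree_mul _ _).trans (by rw [totalDegree_C]; omega)
  have hm : ∀ m ∈ q.support, m.degree ≤ d := fun m hm => (le_totalDegree hm).trans hq
  constructor
  · conv_lhs => rw [q.as_sum]
    rw [map_sum, ← Finset.sum_sub_distrib]
    exact totalDegree_finsetSum_le fun m h => (hmon d m _ (hm m h)).1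
  · intro hd
    conv_lhs => rw [q.as_sum]
    conv_rhs => rw [q.as_sum]
    rw [map_sum]
    exact Finset.sum_congr rfl fun m h => (hmon d m _ (hm m h)).2 hd

/-- Conjugating a shear by a translation along another axis translates the argument of its
polynomial, so the commutator is the shear by a finite difference. -/
theorem shear_commutator {i j : Fin n} (hij : i ≠ j) (a : R)
    (q : supported R ({i}ᶜ : Set (Fin n))) :
    shear j ⟨C a, C_mem_supported _ a⟩ * shear i q * (shear j ⟨C a, C_mem_supported _ a⟩)⁻¹ *
      (shear i q)⁻¹ =
      shear i (⟨shift j (-a) q, shift_mem_supported _ q.2⟩ - q) := by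
  rw [mul_inv_eq_iff_eq_mul, ← shear_add, sub_add_cancel, mul_inv_eq_iff_eq_mul]
  refine PolyAut.ext_comp fun l => ?_
  simp only [Units.val_mul, mul_comp, shear_val]
  by_cases hi : l = i
  · subst hi
    rw [shearEnd_comp_of_ne hij, shearEnd_comp_self, bind₁_X_right, shearEnd_comp_self, map_add,
      bind₁_X_right, shearEnd_comp_of_ne hij]
    have : bind₁ (shearEnd j (C a)).comp (shift j (-a) (q : MvPolynomial (Fin n) R)) = q := by
      rw [shift, bind₁_bind₁]
      conv_rhs => rw [← AlgHom.id_apply (R := R) (q : MvPolynomial (Fin n) R), ← bind₁_X_left]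
      congr 2
      funext l
      by_cases hl : l = j
      · subst hl
        simp [shearEnd_comp_self]
      · simp [shearEnd_comp_of_ne hl]
    rw [this]
  · rw [shearEnd_comp_of_ne hi, bind₁_X_right]
    by_cases hj : l = j
    · subst hj
      rw [shearEnd_comp_self, map_add, bind₁_X_right, shearEnd_comp_of_ne hi, bind₁_C_right]
    · rw [shearEnd_comp_of_ne hj, bind₁_X_right, shearEnd_comp_of_ne hi]

end Shift

/-! ### From one nontrivial shear to all shears. -/

section ShearsOfShear

universe u

variable {n : ℕ} {k : Type u} [Field k] {P : Subgroup (PolyAut n k)}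

theorem IsLimitClosedNormal.conj_mul_inv_mem (hP : IsLimitClosedNormal P) {f g : PolyAut n k}
    (hf : f ∈ P) (hg : g ∈ SAut n k) : g * f * g⁻¹ * f⁻¹ ∈ P :=
  mul_mem (hP.conj_mem g hg f hf) (inv_mem hf)

theorem IsLimitClosedNormal.mul_conj_inv_mem (hP : IsLimitClosedNormal P) {f g : PolyAut n k}
    (hf : f ∈ P) (hg : g ∈ SAut n k) : f * g * f⁻¹ * g⁻¹ ∈ P := by
  rw [mul_assoc, mul_assoc, ← mul_assoc g]
  exact mul_mem hf (hP.conj_mem g hg _ (inv_mem hf))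

/-- Induction on the degree: a nonzero finite difference gives a shear of smaller degree in the same
direction. If all differences vanish, `q` is constant as a function, hence as a polynomial since `k`
is infinite. -/
theorem IsLimitClosedNormal.exists_translation_mem [Infinite k] (hP : IsLimitClosedNormal P)
    {i : Fin n} (d : ℕ) (q : supported k ({i}ᶜ : Set (Fin n))) (hq : q ≠ 0)
    (hd : (q : MvPolynomial (Fin n) k).totalDegree ≤ d) (hmem : shear i q ∈ P) :
    ∃ a : k, a ≠ 0 ∧ shear i ⟨C a, C_mem_supported _ a⟩ ∈ P := by
  induction d generalizing q with
  | zero =>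
    rw [Nat.le_zero, totalDegree_eq_zero_iff_eq_C] at hd
    obtain ⟨q, hq'⟩ := q
    refine ⟨coeff 0 q, ?_, ?_⟩
    · intro h
      rw [h, C_0] at hd
      exact hq (Subtype.ext hd)
    · convert hmem using 2
      exact Subtype.ext hd.symm
  | succ d ih =>
    by_cases h : ∃ j ≠ i, ∃ a : k, shift j a (q : MvPolynomial (Fin n) k) ≠ q
    · obtain ⟨j, hj, a, ha⟩ := h
      have := hP.conj_mul_inv_mem hmem (shear_mem_SAut j ⟨C (-a), C_mem_supported _ _⟩)
      rw [shear_commutator hj.symm] at this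
      refine ih _ ?_ ?_ this
      · rw [Ne, sub_eq_zero, Subtype.ext_iff, neg_neg]
        exact ha
      · rw [neg_neg]
        exact (totalDegree_shift_sub_self j a _ hd).1
    · push Not at h
      have hinv : ∀ j (a : k), shift j a (q : MvPolynomial (Fin n) k) = q := by
        intro j a
        by_cases hj : j = i
        · subst hj
          exact shift_eq_self_of_mem_supported a q.2
        · exact h j hj a
      have hC : (q : MvPolynomial (Fin n) k) = C (eval 0 (q : MvPolynomial (Fin n) k)) := by
        refine MvPolynomial.funext fun x => ?_
        rw [eval_C]
        refine apply_eq_of_forall_apply_update_eq (fun x => eval x (q : MvPolynomial (Fin n) k))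
          (fun x j b => ?_) x 0
        conv_rhs => rw [← hinv j (b - x j)]
        rw [eval_shift]
        simp
      refine ih q hq ?_ hmem
      rw [hC, totalDegree_C]
      exact Nat.zero_le _

/-- Commutators spread the translation to all axes and all lengths. Finite differences of powers of
a variable, separated according to the powers of the step, then give every monomial shear. -/
theorem IsLimitClosedNormal.shear_mem_of_translation_mem [Infinite k] [Nontrivial (Fin n)]
    (hP : IsLimitClosedNormal P) {i : Fin n} {a : k} (ha : a ≠ 0)
    (hmem : shear i ⟨C a, C_mem_supported _ a⟩ ∈ P) (l : Fin n)
    (q : supported k ({l}ᶜ : Set (Fin n))) : shear l q ∈ P := by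
  have hshift : ∀ {i j : Fin n} (_ : i ≠ j) {a : k}
      (_ : shear j ⟨C a, C_mem_supported _ a⟩ ∈ P) (q : supported k ({i}ᶜ : Set (Fin n))),
      shear i (⟨shift j (-a) q, shift_mem_supported _ q.2⟩ - q) ∈ P := by
    intro i j hij a ha q
    rw [← shear_commutator hij]
    exact hP.mul_conj_inv_mem ha (shear_mem_SAut i q)
  have hne : ∀ {i j : Fin n} (_ : j ≠ i) {a : k} (_ : a ≠ 0)
      (_ : shear i ⟨C a, C_mem_supported _ a⟩ ∈ P) (b : k),
      shear j ⟨C b, C_mem_supported _ b⟩ ∈ P := by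
    intro i j hij a ha hmem b
    -- The difference of `(-b / a) xᵢ` for the step `-a` is the constant `b`.
    convert hshift hij hmem ⟨C (-b / a) * X i,
      (supported k _).mul_mem (C_mem_supported _ _) (X_mem_supported' hij.symm)⟩ using 2
    refine Subtype.ext ?_
    change C b = shift i (-a) (C (-b / a) * X i) - C (-b / a) * X i
    rw [map_mul, shift_C, shift_X_self, mul_add, add_sub_cancel_left, ← C_mul]
    congr 1
    field_simp
  have htrans : ∀ (j : Fin n) (b : k), shear j ⟨C b, C_mem_supported _ b⟩ ∈ P := by
    intro j b
    by_cases hij : j = i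
    · subst hij
      -- The original axis is reached by a detour through a second one.
      obtain ⟨j', hj'⟩ := exists_ne j
      exact hne hj'.symm one_ne_zero (hne hj' ha hmem 1) b
    · exact hne hij ha hmem b
  -- Requiring all multiples `c • q` makes this a linear subspace, to which interpolation applies.
  let W : Submodule k (supported k ({l}ᶜ : Set (Fin n))) :=
    { carrier := {q | ∀ c : k, shear l (c • q) ∈ P}
      add_mem' := fun hp hq c => by
        rw [smul_add, shear_add]
        exact mul_mem (hp c) (hq c)
      zero_mem' := fun c => by rw [smul_zero, shear_zero]; exact one_mem _
      smul_mem' := fun b q hq c => by rw [smul_smul]; exact hq _ }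
  have hW : ∀ (j : Fin n) (_ : l ≠ j) (b : k) (q : supported k ({l}ᶜ : Set (Fin n))),
      (⟨shift j b q, shift_mem_supported _ q.2⟩ - q : supported k ({l}ᶜ : Set (Fin n))) ∈ W := by
    intro j hj b q c
    convert hshift hj (htrans j (-b)) (c • q) using 2
    refine Subtype.ext ?_
    simp [smul_sub]
  suffices h : q ∈ W by simpa using h 1
  have hmono : ∀ (m : Fin n →₀ ℕ) (hm : m l = 0),
      (⟨monomial m 1, mem_supported.2 fun j hj => by
        rintro rfl
        rw [Finset.mem_coe, vars_monomial one_ne_zero, Finsupp.mem_support_iff] at hj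
        exact hj hm⟩ : supported k ({l}ᶜ : Set (Fin n))) ∈ W := by
    intro m hm
    obtain ⟨j, hj⟩ := exists_ne l
    -- In the difference of the power `d` of `x_j` the wanted power `m j` appears with coefficient
    -- `d.choose (m j)`; in positive characteristic `d = m j + 1` may fail.
    obtain ⟨d, hd, hdk⟩ := exists_lt_cast_choose_ne_zero k (m j)
    have hmonX : ∀ e : ℕ,
        monomial (m.erase j) (1 : k) * X j ^ e ∈ supported k ({l}ᶜ : Set (Fin n)) := by
      intro e
      refine (supported k _).mul_mem (mem_supported.2 fun i hi => ?_)
        ((supported k _).pow_mem (X_mem_supported' hj) e)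
      rintro rfl
      rw [Finset.mem_coe, vars_monomial one_ne_zero, Finsupp.mem_support_iff] at hi
      rw [Finsupp.erase_ne hj.symm] at hi
      exact hi hm
    have key := Submodule.mem_of_forall_sum_pow_smul_mem W (Finset.range d)
      (fun e => (d.choose e : k) • ⟨_, hmonX e⟩) (fun e => d - e)
      (fun e he e' he' h => by
        have := Finset.mem_range.1 he
        have := Finset.mem_range.1 he'
        simp only at h
        omega)
      (fun a => by
        convert hW j hj.symm a ⟨_, hmonX d⟩ using 1
        refine Subtype.ext ?_
        simp only [AddSubmonoidClass.coe_finsetSum, SetLike.val_smul, AddSubgroupClass.coe_sub]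
        rw [map_mul, map_pow, shift_X_self, shift_eq_self_of_mem_supported, add_pow,
          Finset.sum_range_succ]
        · simp only [Nat.sub_self, pow_zero, mul_one, Nat.choose_self, Nat.cast_one, mul_add,
            add_sub_cancel_right, Finset.mul_sum]
          refine Finset.sum_congr rfl fun e _ => ?_
          rw [smul_smul, smul_eq_C_mul, C_mul, C_pow, map_natCast]
          ring
        · refine mem_supported.2 fun i hi => ?_
          rintro rfl
          rw [Finset.mem_coe, vars_monomial one_ne_zero, Finsupp.mem_support_iff] at hi
          exact hi Finsupp.erase_same)
      (Finset.mem_range.2 hd)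
    have h2 := W.smul_mem (d.choose (m j) : k)⁻¹ key
    rw [smul_smul, inv_mul_cancel₀ hdk, one_smul] at h2
    convert h2 using 2
    rw [X_pow_eq_monomial, monomial_mul, mul_one, Finsupp.erase_add_single]
  have hq : q = ∑ m ∈ (q : MvPolynomial (Fin n) k).support.attach,
      coeff m.1 (q : MvPolynomial (Fin n) k) • (⟨monomial m.1 1, mem_supported.2 fun j hj => by
        rw [Finset.mem_coe, vars_monomial one_ne_zero] at hj
        exact mem_supported.1 q.2 ((mem_vars_iff_mem_support _).2 ⟨m.1, m.2, hj⟩)⟩ :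
          supported k ({l}ᶜ : Set (Fin n))) := by
    refine Subtype.ext ?_
    conv_lhs => rw [(q : MvPolynomial (Fin n) k).as_sum]
    rw [← Finset.sum_attach]
    simp [smul_monomial]
  rw [hq]
  refine Submodule.sum_mem _ fun m _ => W.smul_mem _ (hmono m.1 ?_)
  by_contra h
  exact mem_supported.1 q.2 ((mem_vars_iff_mem_support _).2
    ⟨m.1, m.2, Finsupp.mem_support_iff.2 h⟩) rfl

end ShearsOfShear

/-! ### Degenerating a nontrivial element to a shear. -/

section Limit

universe u

variable {σ : Type*} {k : Type u} [Field k]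

theorem X_none_dvd_sub_rename_spec (p : MvPolynomial (Option σ) k) :
    X none ∣ p - rename some (spec 0 p) := by
  induction p using MvPolynomial.induction_on with
  | C a => simp
  | add p q hp hq =>
    rw [map_add, map_add, add_sub_add_comm]
    exact dvd_add hp hq
  | mul_X p o hp =>
    cases o with
    | none => simp
    | some i =>
      rw [map_mul, map_mul, spec_X_some, rename_X, ← sub_mul]
      exact dvd_mul_of_dvd_left hp _

theorem ne_zero_of_mem_support_of_spec_zero {p : MvPolynomial (Option σ) k} (hp : spec 0 p = 0)
    {M : Option σ →₀ ℕ} (hM : M ∈ p.support) : M none ≠ 0 := by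
  classical
  obtain ⟨q, hq⟩ := X_none_dvd_sub_rename_spec p
  rw [hp, map_zero, sub_zero] at hq
  rw [mem_support_iff, hq, coeff_X_mul'] at hM
  intro h
  rw [if_neg (Finsupp.notMem_support_iff.2 h)] at hM
  exact hM rfl

/-- Compares a substitution having a pole at `t = 0` with a regular one, monomial by monomial and
with denominators cleared. -/
theorem aeval_monomial_mul_pow {τ S : Type*} [Fintype τ] [CommRing S] [Algebra k S] [DecidableEq τ]
    (g g' : τ → S) (a b : τ) (u v : S)
    (h : ∀ o, g o * (if o = a then u else 1) = g' o * (if o = b then v else 1))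
    (M : τ →₀ ℕ) (c : k) :
    aeval g (monomial M c) * u ^ M a = aeval g' (monomial M c) * v ^ M b := by
  have hpow : ∀ (a : τ) (u : S), u ^ M a = ∏ o, (if o = a then u else 1) ^ M o := by
    intro a u
    rw [Finset.prod_eq_single a (fun o _ ho => by rw [if_neg ho, one_pow])
      (fun h => absurd (Finset.mem_univ _) h), if_pos rfl]
  rw [aeval_monomial, aeval_monomial, Finsupp.prod_fintype _ _ fun _ => pow_zero _,
    Finsupp.prod_fintype _ _ fun _ => pow_zero _, hpow a u, hpow b v, mul_assoc, mul_assoc,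
    ← Finset.prod_mul_distrib, ← Finset.prod_mul_distrib]
  simp only [← mul_pow, h]

variable {n : ℕ} {P : Subgroup (PolyAut n k)}

/-- `B / A` is the largest of the ratios `num / den`, an extremal slope of a Newton polygon. -/
theorem exists_leading_ratio {ι : Type*} (s : Finset ι) (hs : s.Nonempty) (num den : ι → ℕ)
    (hden : ∀ x ∈ s, den x ≠ 0) :
    ∃ A B : ℕ, A ≠ 0 ∧ (∀ x ∈ s, A * num x ≤ B * den x) ∧ ∃ x ∈ s, A * num x = B * den x := by
  obtain ⟨x, hx, hmax⟩ := s.exists_max_image (fun x => (num x : ℚ) / den x) hs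
  refine ⟨den x, num x, hden x hx, fun y hy => ?_, x, hx, mul_comm _ _⟩
  have h := hmax y hy
  rw [div_le_div_iff₀ (by exact_mod_cast Nat.pos_of_ne_zero (hden y hy))
    (by exact_mod_cast Nat.pos_of_ne_zero (hden x hx))] at h
  rw [mul_comm]
  exact_mod_cast h

/-- The leading form of `p` among the monomials `M` satisfying `A (Mᵢ + e) ≤ B M₀`, where `M₀`
is the exponent of the parameter. -/
noncomputable def leadPart (A B e : ℕ) (i : Fin n) (p : MvPolynomial (Option (Fin n)) k) :
    MvPolynomial (Option (Fin n)) k :=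
  ∑ M ∈ p.support with A * (M (some i) + e) = B * M none, monomial M (coeff M p)

theorem coeff_leadPart (A B e : ℕ) (i : Fin n) (p : MvPolynomial (Option (Fin n)) k)
    (M : Option (Fin n) →₀ ℕ) :
    coeff M (leadPart A B e i p) =
      if A * (M (some i) + e) = B * M none then coeff M p else 0 := by
  rw [leadPart, coeff_sum]
  simp only [coeff_monomial, Finset.sum_ite_eq', Finset.mem_filter, mem_support_iff]
  by_cases h : coeff M p = 0 <;> simp [h]

/-- The substitution giving the rescaled family. -/
noncomputable def rescaleVal (A : ℕ) (i : Fin n) (ℓ : MvPolynomial (Option (Fin n)) k) (c : k)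
    (o : Option (Fin n)) : MvPolynomial (Option (Fin n)) k :=
  o.elim (C c) fun j => if j = i then X none ^ A * X (some i) - ℓ else X (some j)

/-- The rescaled family. -/
noncomputable def rescale (A B e : ℕ) (i : Fin n) (ℓ : MvPolynomial (Option (Fin n)) k) (c : k)
    (p : MvPolynomial (Option (Fin n)) k) : MvPolynomial (Option (Fin n)) k :=
  ∑ M ∈ p.support, X none ^ (B * M none - A * (M (some i) + e)) *
    bind₁ (rescaleVal A i ℓ c) (monomial M (coeff M p))

/-- At `t = 0` only the monomials on the extremal line survive, and `t ^ A * xᵢ - ℓ` becomes `-ℓ`.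
-/
theorem spec_zero_rescale {A : ℕ} (hA : A ≠ 0) (B e : ℕ) (i : Fin n)
    (ℓ : MvPolynomial (Option (Fin n)) k) (c : k) (p : MvPolynomial (Option (Fin n)) k)
    (hp : ∀ M ∈ p.support, A * (M (some i) + e) ≤ B * M none) :
    spec 0 (rescale A B e i ℓ c p) =
      aeval (fun o : Option (Fin n) => o.elim (C c) fun j => if j = i then -spec 0 ℓ else X j)
        (leadPart A B e i p) := by
  rw [rescale, map_sum, leadPart, map_sum, Finset.sum_filter]
  refine Finset.sum_congr rfl fun M hM => ?_
  rw [map_mul, map_pow, spec_X_none, C_0]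
  split_ifs with h
  · rw [h, Nat.sub_self, pow_zero, one_mul, spec_bind₁, bind₁]
    congr 2
    funext o
    cases o with
    | none => simp [rescaleVal]
    | some j =>
      by_cases hj : j = i
      · subst hj
        simp [rescaleVal, zero_pow hA]
      · simp [rescaleVal, hj]
  · have := hp M hM
    rw [zero_pow (by omega), zero_mul]

/-- The pole of order `A * Mᵢ` caused by substituting `xᵢ - t^{-A} ℓ` in a monomial is absorbed by
the factor `t ^ (B * M₀)` coming from the parameter, with `t ^ (A * e)` to spare. -/
theorem bind₁_shearEnd_spec {A B e : ℕ} {i : Fin n} {t : k} (ht : t ≠ 0) (c : k)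
    (ℓ : MvPolynomial (Option (Fin n)) k) (p : MvPolynomial (Option (Fin n)) k)
    (hp : ∀ M ∈ p.support, A * (M (some i) + e) ≤ B * M none) :
    bind₁ (shearEnd i (-(C (t ^ A)⁻¹ * spec t ℓ))).comp (spec (t ^ B * c) p) =
      C t ^ (A * e) * spec t (rescale A B e i ℓ c p) := by
  have hCt : (C t : MvPolynomial (Fin n) k) ≠ 0 := by rwa [Ne, C_eq_zero]
  conv_lhs => rw [p.as_sum]
  rw [rescale, map_sum, map_sum, map_sum, Finset.mul_sum]
  refine Finset.sum_congr rfl fun M hM => ?_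
  have hM := hp M hM
  have key := aeval_monomial_mul_pow (k := k)
    (fun o => bind₁ (shearEnd i (-(C (t ^ A)⁻¹ * spec t ℓ))).comp (spec (t ^ B * c) (X o)))
    (fun o => spec t (rescaleVal A i ℓ c o)) (some i) none (C t ^ A) (C t ^ B) (by
      intro o
      cases o with
      | none => simp [rescaleVal, mul_comm]
      | some j =>
        by_cases hj : j = i
        · subst hj
          simp only [spec_X_some, bind₁_X_right, shearEnd_comp_self, if_true, rescaleVal,
            Option.elim_some, map_sub, map_mul, map_pow, spec_X_none, reduceCtorEq, if_false]
          have : (C (t ^ A)⁻¹ * C t ^ A : MvPolynomial (Fin n) k) = 1 := by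
            rw [← C_pow, ← C_mul, inv_mul_cancel₀ (pow_ne_zero _ ht), C_1]
          linear_combination (-spec t ℓ) * this
        · simp [rescaleVal, hj, shearEnd_comp_of_ne hj]) M (coeff M p)
  have h1 : aeval (fun o => bind₁ (shearEnd i (-(C (t ^ A)⁻¹ * spec t ℓ))).comp
      (spec (t ^ B * c) (X o))) (monomial M (coeff M p)) =
      bind₁ (shearEnd i (-(C (t ^ A)⁻¹ * spec t ℓ))).comp
        (spec (t ^ B * c) (monomial M (coeff M p))) := by
    rw [← AlgHom.comp_apply]
    exact (DFunLike.congr_fun (aeval_unique ((bind₁ _).comp (spec _))) _).symm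
  rw [h1] at key
  rw [map_mul, spec_bind₁, map_pow, spec_X_none]
  change _ = _ * (_ * aeval (fun o => spec t (rescaleVal A i ℓ c o)) _)
  refine mul_right_cancel₀ (pow_ne_zero (M (some i)) (pow_ne_zero A hCt)) ?_
  rw [key, ← pow_mul, ← pow_mul,
    show B * M none = A * e + (B * M none - A * (M (some i) + e)) + A * M (some i) by
      rw [mul_add] at hM ⊢; omega, pow_add, pow_add]
  rw [show A * e + (B * M none - A * (M (some i) + e)) + A * M (some i) - A * (M (some i) + e) =
    B * M none - A * (M (some i) + e) by rw [mul_add] at hM ⊢; omega]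
  ring

/-- Conjugation by `x_{i₁} ↦ x_{i₁} + t^{-A} ℓ` adds `t^{-A}` times the component `ι` to the
component `i₁`. Hence the components other than `i₁` carry an extra `1` in the numerator of the
ratio: they keep a factor `t ^ A` and die in the limit, while component `i₁` converges to the sum of
two leading parts. -/
theorem IsLimitClosedNormal.exists_shear_mem_of_family [Infinite k] [Nontrivial (Fin n)]
    (hP : IsLimitClosedNormal P) (Δ : Fin n → MvPolynomial (Option (Fin n)) k)
    (h0 : ∀ i, spec 0 (Δ i) = 0) (hne : ∃ i, Δ i ≠ 0)
    (hmem : ∀ s : k, ∃ f ∈ P, ∀ i, (f : PolyEnd n k).comp i = X i + spec s (Δ i)) :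
    ∃ (i : Fin n) (q : supported k ({i}ᶜ : Set (Fin n))), q ≠ 0 ∧ shear i q ∈ P := by
  classical
  obtain ⟨i₁, -⟩ := exists_pair_ne (Fin n)
  obtain ⟨A, B, hA, hle, ⟨i₂, M⟩, hM, heq⟩ := exists_leading_ratio
    (Finset.univ.sigma fun i => (Δ i).support)
    (by
      obtain ⟨i, hi⟩ := hne
      obtain ⟨M, hM⟩ := support_nonempty.2 hi
      exact ⟨⟨i, M⟩, Finset.mem_sigma.2 ⟨Finset.mem_univ _, hM⟩⟩)
    (fun x => x.2 (some i₁) + if x.1 = i₁ then 0 else 1) (fun x => x.2 none)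
    (fun x hx => ne_zero_of_mem_support_of_spec_zero (h0 x.1) (Finset.mem_sigma.1 hx).2)
  have hle₁ : ∀ M ∈ (Δ i₁).support, A * (M (some i₁) + 0) ≤ B * M none := fun M hM => by
    simpa using hle ⟨i₁, M⟩ (Finset.mem_sigma.2 ⟨Finset.mem_univ _, hM⟩)
  have hle₂ : ∀ i ≠ i₁, ∀ M ∈ (Δ i).support, A * (M (some i₁) + 1) ≤ B * M none :=
    fun i hi M hM => by
      simpa [hi] using hle ⟨i, M⟩ (Finset.mem_sigma.2 ⟨Finset.mem_univ _, hM⟩)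
  have hM := (Finset.mem_sigma.1 hM).2
  -- The two leading parts share no monomial: `A * M` and `A * (M + 1)` cannot both equal `B * M₀`,
  -- as `A ≠ 0`.
  obtain ⟨ι, hι, hG⟩ : ∃ ι ≠ i₁,
      leadPart A B 0 i₁ (Δ i₁) + leadPart A B 1 i₁ (Δ ι) ≠ 0 := by
    by_cases h : i₂ = i₁
    · subst h
      obtain ⟨ι, hι⟩ := exists_ne i₂
      refine ⟨ι, hι, fun h => mem_support_iff.1 hM ?_⟩
      have := congrArg (coeff M) h
      simp only [if_true] at heq
      rwa [coeff_add, coeff_leadPart, coeff_leadPart, if_pos heq, if_neg, add_zero, coeff_zero]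
        at this
      rw [← heq, add_zero, mul_add, mul_one]
      omega
    · refine ⟨i₂, h, fun h' => mem_support_iff.1 hM ?_⟩
      have := congrArg (coeff M) h'
      simp only [if_neg h] at heq
      rwa [coeff_add, coeff_leadPart, coeff_leadPart, if_pos heq, if_neg, zero_add, coeff_zero]
        at this
      rw [← heq, add_zero, mul_add, mul_one]
      omega
  obtain ⟨y, hy⟩ : ∃ y, eval y (leadPart A B 0 i₁ (Δ i₁) + leadPart A B 1 i₁ (Δ ι)) ≠ 0 := by
    by_contra! h
    exact hG (MvPolynomial.funext fun y => by rw [h, map_zero])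
  -- The constant is chosen so that `-ℓ` takes the value `y (some i₁)` at `y`; the limit shear is
  -- then nonzero at that point.
  set ℓ : MvPolynomial (Option (Fin n)) k := X (some ι) + C (-y (some i₁) - y (some ι)) with hℓ
  have hspecℓ : ∀ t, spec t ℓ = X ι + C (-y (some i₁) - y (some ι)) := fun t => by simp [hℓ]
  have hℓsupp : (X ι + C (-y (some i₁) - y (some ι)) : MvPolynomial (Fin n) k) ∈
      supported k ({i₁}ᶜ : Set (Fin n)) :=
    (supported k _).add_mem (X_mem_supported' hι) (C_mem_supported _ _)
  set g : Option (Fin n) → MvPolynomial (Fin n) k :=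
    fun o => o.elim (C (y none)) fun j => if j = i₁ then -spec 0 ℓ else X j with hg
  have hq : aeval g (leadPart A B 0 i₁ (Δ i₁) + leadPart A B 1 i₁ (Δ ι)) ∈
      supported k ({i₁}ᶜ : Set (Fin n)) := by
    refine bind₁_mem_supported (s := Set.univ) (by rw [supported_univ]; trivial) fun o _ => ?_
    cases o with
    | none => exact C_mem_supported _ _
    | some j =>
      by_cases hj : j = i₁
      · simp only [hg, Option.elim_some, if_pos hj, hspecℓ]
        exact (supported k _).neg_mem hℓsupp
      · simp only [hg, Option.elim_some, if_neg hj]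
        exact X_mem_supported' hj
  refine ⟨i₁, ⟨_, hq⟩, ?_, ?_⟩
  · intro h
    have h : aeval g (leadPart A B 0 i₁ (Δ i₁) + leadPart A B 1 i₁ (Δ ι)) = 0 :=
      congrArg Subtype.val h
    refine hy ?_
    have hev : ∀ p : MvPolynomial (Option (Fin n)) k,
        eval (fun j => y (some j)) (aeval g p) = eval y p := by
      intro p
      induction p using MvPolynomial.induction_on with
      | C a => simp
      | add p q hp hq => rw [map_add, map_add, map_add, hp, hq]
      | mul_X p o hp =>
        rw [map_mul, map_mul, hp, map_mul, aeval_X, eval_X]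
        congr 1
        cases o with
        | none => simp [hg]
        | some j =>
          by_cases hj : j = i₁
          · simp [hg, hj, hspecℓ]
          · simp [hg, hj]
    rw [← hev, h, map_zero]
  · refine hP.limit_mem (fun i => X (some i) + if i = i₁ then
      rescale A B 0 i₁ ℓ (y none) (Δ i₁) + rescale A B 1 i₁ ℓ (y none) (Δ ι) else
      X none ^ A * rescale A B 1 i₁ ℓ (y none) (Δ i)) ?_ _ (shear_mem_SAut _ _) 0 ?_
    · refine (Set.finite_singleton (0 : k)).infinite_compl.mono fun t (ht : t ≠ 0) => ?_
      -- For `t ≠ 0` the family consists of conjugates of the members with parameter `t ^ B * y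
      -- none`.
      obtain ⟨f, hf, hfc⟩ := hmem (t ^ B * y none)
      refine ⟨_, hP.conj_mem _ (shear_mem_SAut i₁ ⟨C (t ^ A)⁻¹ * spec t ℓ,
        (supported k _).mul_mem (C_mem_supported _ _) (by rw [hspecℓ]; exact hℓsupp)⟩) f hf,
        fun i => ?_⟩
      have hCt : (C (t ^ A)⁻¹ * C t ^ A : MvPolynomial (Fin n) k) = 1 := by
        rw [← C_pow, ← C_mul, inv_mul_cancel₀ (pow_ne_zero _ ht), C_1]
      simp only [Units.val_mul, mul_comp, shear_val, shear_inv_val]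
      by_cases hi : i = i₁
      · subst hi
        rw [shearEnd_comp_self, if_pos rfl, hspecℓ]
        simp only [map_add, map_mul, bind₁_X_right, bind₁_C_right, hfc, shearEnd_comp_self,
          shearEnd_comp_of_ne hι, spec_X_some]
        have e1 := bind₁_shearEnd_spec ht (y none) ℓ (Δ i) hle₁
        have e2 := bind₁_shearEnd_spec ht (y none) ℓ (Δ ι) (hle₂ ι hι)
        rw [hspecℓ] at e1 e2
        rw [e1, e2, mul_zero, pow_zero, mul_one]
        linear_combination (spec t (rescale A B 1 i ℓ (y none) (Δ ι))) * hCt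
      · rw [shearEnd_comp_of_ne hi, if_neg hi, bind₁_X_right, hfc, map_add, bind₁_X_right,
          shearEnd_comp_of_ne hi, bind₁_shearEnd_spec ht (y none) ℓ (Δ i) (hle₂ i hi), mul_one]
        simp
    · intro i
      rw [shear_val]
      by_cases hi : i = i₁
      · subst hi
        rw [shearEnd_comp_self, if_pos rfl]
        change X i + aeval g (_ + _) = _
        simp only [map_add]
        rw [spec_X_some, spec_zero_rescale hA B 0 i ℓ (y none) (Δ i) hle₁,
          spec_zero_rescale hA B 1 i ℓ (y none) (Δ ι) (hle₂ ι hι)]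
      · rw [shearEnd_comp_of_ne hi, if_neg hi]
        simp [zero_pow hA]

/-- The components of the commutator of `f` with the translation by the parameter along the
`l`-th axis. -/
noncomputable def commFamily (f : PolyAut n k) (l i : Fin n) : MvPolynomial (Option (Fin n)) k :=
  bind₁ (fun j => bind₁ (fun m => X (some m) -
      Pi.single (M := fun _ => MvPolynomial (Option (Fin n)) k) l (X none) m)
    (((f⁻¹ : PolyAut n k) : PolyEnd n k).comp j) +
      Pi.single (M := fun _ => MvPolynomial (Option (Fin n)) k) l (X none) j)
    ((f : PolyEnd n k).comp i)

theorem comp_commutator_translation (f : PolyAut n k) (l i : Fin n) (s : k) :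
    ((f * shear l ⟨C s, C_mem_supported _ s⟩ * f⁻¹ * (shear l ⟨C s, C_mem_supported _ s⟩)⁻¹ :
      PolyAut n k) : PolyEnd n k).comp i = spec s (commFamily f l i) := by
  have hs : ∀ j, spec s (Pi.single (M := fun _ => MvPolynomial (Option (Fin n)) k) l (X none) j) =
      Pi.single (M := fun _ => MvPolynomial (Fin n) k) l (C s) j := by
    intro j
    by_cases h : j = l
    · subst h; simp
    · simp [h]
  have hneg : (shearEnd l (-C s)).comp =
      fun m => X m - Pi.single (M := fun _ => MvPolynomial (Fin n) k) l (C s) m := by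
    funext m
    rw [shearEnd, Pi.single_neg, sub_eq_add_neg]
    rfl
  simp only [Units.val_mul, mul_comp, shear_val, shear_inv_val, commFamily, spec_bind₁, map_add,
    map_sub, spec_X_some, hs, hneg]
  rw [bind₁_bind₁, bind₁_bind₁]
  simp only [shearEnd, map_add, bind₁_X_right]
  refine congrArg (fun g => bind₁ g ((f : PolyEnd n k).comp i)) (funext fun j => ?_)
  congr 1
  by_cases h : j = l
  · subst h
    rw [Pi.single_eq_same, bind₁_C_right]
  · rw [Pi.single_eq_of_ne h, map_zero]

/-- Either some commutator family with translations is nonconstant and degenerates to a shear, or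
`f` commutes with all translations and is itself a translation. -/
theorem IsLimitClosedNormal.exists_shear_mem [Infinite k] [Nontrivial (Fin n)]
    (hP : IsLimitClosedNormal P) (hne : P ≠ ⊥) :
    ∃ (i : Fin n) (q : supported k ({i}ᶜ : Set (Fin n))), q ≠ 0 ∧ shear i q ∈ P := by
  obtain ⟨⟨f, hf⟩, hf1⟩ := Subgroup.ne_bot_iff_exists_ne_one.1 hne
  by_cases hcomm : ∃ l i, commFamily f l i ≠ X (some i)
  · obtain ⟨l, i, hi⟩ := hcomm
    refine hP.exists_shear_mem_of_family (fun i => commFamily f l i - X (some i)) (fun i => ?_)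
      ⟨i, sub_ne_zero.2 hi⟩ fun s => ⟨_, hP.mul_conj_inv_mem hf
        (shear_mem_SAut l ⟨C s, C_mem_supported _ s⟩), fun i => ?_⟩
    · rw [map_sub, ← comp_commutator_translation, sub_eq_zero, spec_X_some, ← one_comp]
      have : (⟨C 0, C_mem_supported _ 0⟩ : supported k ({l}ᶜ : Set (Fin n))) = 0 :=
        Subtype.ext C_0
      rw [this, shear_zero]
      simp
    · rw [comp_commutator_translation, map_sub, spec_X_some, add_sub_cancel]
  · push Not at hcomm
    have hc : ∀ (l : Fin n) (s : k), f * shear l ⟨C s, C_mem_supported _ s⟩ =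
        shear l ⟨C s, C_mem_supported _ s⟩ * f := by
      intro l s
      rw [← mul_inv_eq_iff_eq_mul, ← mul_inv_eq_one]
      refine PolyAut.ext_comp fun i => ?_
      rw [comp_commutator_translation, hcomm, spec_X_some, Units.val_one, one_comp]
    have hev : ∀ (i l : Fin n) (s : k) (x : Fin n → k),
        eval (Function.update x l (x l + s)) ((f : PolyEnd n k).comp i) =
          eval x ((f : PolyEnd n k).comp i) + if i = l then s else 0 := by
      intro i l s x
      have h := congrArg (fun g : PolyAut n k => eval x ((g : PolyEnd n k).comp i)) (hc l s)
      simp only [Units.val_mul, mul_comp, shear_val] at h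
      rw [← shift, eval_shift] at h
      rw [h]
      by_cases hi : i = l
      · subst hi
        rw [shearEnd_comp_self]
        simp
      · rw [shearEnd_comp_of_ne hi]
        simp [hi]
    have htr : ∀ i, (f : PolyEnd n k).comp i = X i + C (eval 0 ((f : PolyEnd n k).comp i)) := by
      intro i
      refine MvPolynomial.funext fun x => ?_
      have := apply_eq_of_forall_apply_update_eq
        (fun x => eval x ((f : PolyEnd n k).comp i) - x i) (fun x l b => ?_) x 0
      · simp only [Pi.zero_apply, sub_zero] at this
        rw [map_add, eval_X, eval_C, ← this, add_sub_cancel]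
      · have h := hev i l (b - x l) x
        rw [add_sub_cancel] at h
        simp only [h]
        by_cases hi : i = l
        · subst hi
          simp
          ring
        · simp [hi]
    obtain ⟨i, hi⟩ : ∃ i, eval 0 ((f : PolyEnd n k).comp i) ≠ 0 := by
      by_contra! h
      refine hf1 (Subtype.ext (PolyAut.ext_comp fun i => ?_))
      change (f : PolyEnd n k).comp i = _
      rw [htr, h, C_0, add_zero]
      rfl
    -- The commutator of a translation moving `xᵢ` with `x_j ↦ x_j + xᵢ` is a translation along the
    -- axis `j`.
    obtain ⟨j, hj⟩ := exists_ne i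
    have hX : (X i : MvPolynomial (Fin n) k) ∈ supported k ({j}ᶜ : Set (Fin n)) :=
      X_mem_supported' hj.symm
    refine ⟨j, ⟨C (eval 0 ((f : PolyEnd n k).comp i)), C_mem_supported _ _⟩, ?_, ?_⟩
    · rw [Ne, Subtype.ext_iff]
      exact fun h => hi (C_eq_zero.1 h)
    · convert hP.conj_mul_inv_mem hf (shear_mem_SAut j ⟨_, hX⟩) using 1
      rw [eq_mul_inv_iff_mul_eq, eq_mul_inv_iff_mul_eq]
      refine PolyAut.ext_comp fun l => ?_
      simp only [Units.val_mul, mul_comp, shear_val]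
      by_cases hl : l = j
      · subst hl
        rw [shearEnd_comp_self, shearEnd_comp_self, map_add, map_add, map_add, bind₁_X_right,
          bind₁_X_right, bind₁_C_right, bind₁_C_right, htr l, htr i]
        simp only [map_add, bind₁_X_right, bind₁_C_right, shearEnd_comp_self]
        simp
        ring
      · rw [shearEnd_comp_of_ne hl, shearEnd_comp_of_ne hl, bind₁_X_right, htr l, map_add,
          bind₁_X_right, bind₁_C_right, shearEnd_comp_of_ne hl]

theorem IsLimitClosedNormal.elementary_le [Infinite k] [Nontrivial (Fin n)]
    (hP : IsLimitClosedNormal P) (hne : P ≠ ⊥) : elementary n k ≤ P := by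
  obtain ⟨i, q, hq, hmem⟩ := hP.exists_shear_mem hne
  obtain ⟨a, ha, hmem⟩ := hP.exists_translation_mem _ q hq le_rfl hmem
  refine (Subgroup.closure_le P).2 ?_
  rintro _ ⟨i, q, rfl⟩
  exact hP.shear_mem_of_translation_mem ha hmem i q

end Limit

/-! ### Sets of exponents closed under nonvanishing binomial coefficients. -/

section DegreeSet

/-- In characteristic `p` the `p`-part of `q` lies in `D`, so `q` is a power of `p` by minimality;
the remainder of `d` modulo `q` also lies in `D`, hence is zero. In characteristic zero, `1 ∈ D`. -/
theorem dvd_of_choose_closed (K : Type*) [Field K] {D : Set ℕ}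
    (hD : ∀ d ∈ D, ∀ r ≤ d, (d.choose r : K) ≠ 0 → r ∈ D) {q : ℕ} (hq : q ∈ D) (hq0 : 0 < q)
    (hmin : ∀ d ∈ D, 0 < d → q ≤ d) {d : ℕ} (hd : d ∈ D) : q ∣ d := by
  obtain ⟨p, hp⟩ := CharP.exists K
  rcases CharP.char_is_prime_or_zero K p with h | rfl
  · have : Fact p.Prime := ⟨h⟩
    obtain ⟨N, l, hl, rfl⟩ := Nat.exists_eq_pow_mul_and_not_dvd hq0.ne' p h.ne_one
    have hl0 : 0 < l := Nat.pos_of_ne_zero fun h0 => hl (h0 ▸ dvd_zero p)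
    have hmem : p ^ N ∈ D := by
      refine hD _ hq _ (Nat.le_mul_of_pos_right _ hl0) ?_
      rw [cast_choose_pow_mul]
      rwa [Ne, CharP.cast_eq_zero_iff K p]
    have hpow : 0 < p ^ N := pow_pos h.pos N
    have hle := hmin _ hmem hpow
    have hl1 : l = 1 := by
      by_contra h1
      have : p ^ N * 2 ≤ p ^ N * l := Nat.mul_le_mul_left _ (by omega)
      omega
    subst hl1
    rw [mul_one] at hmin ⊢
    rw [Nat.dvd_iff_mod_eq_zero]
    by_contra h0
    have hlt : d % p ^ N < p ^ N := Nat.mod_lt _ hpow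
    have := hmin _ (hD d hd (d % p ^ N) (Nat.mod_le _ _) (by
      rw [cast_choose_mod_pow]
      exact one_ne_zero)) (Nat.pos_of_ne_zero h0)
    omega
  · have := CharP.charP_to_charZero K
    have h1 : 1 ∈ D := hD q hq 1 hq0 (by
      rw [Nat.choose_one_right]
      exact_mod_cast hq0.ne')
    have := hmin 1 h1 one_pos
    rw [show q = 1 by omega]
    exact one_dvd d

end DegreeSet

/-! ### Top components for a weighted grading. -/

section Weights

variable {σ : Type*} {k : Type*} [Field k] {w : σ → ℚ}

/-- All monomials of `F` have weight at most `t`. -/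
def WeightLE (w : σ → ℚ) (F : MvPolynomial σ k) (t : ℚ) : Prop :=
  ∀ m ∈ F.support, Finsupp.weight w m ≤ t

theorem weightLE_of_isWeightedHomogeneous {F : MvPolynomial σ k} {t : ℚ}
    (h : IsWeightedHomogeneous w F t) : WeightLE w F t :=
  fun _ hm => (h (mem_support_iff.1 hm)).le

theorem WeightLE.mul {F G : MvPolynomial σ k} {s t : ℚ} (hF : WeightLE w F s)
    (hG : WeightLE w G t) : WeightLE w (F * G) (s + t) := by
  classical
  intro m hm
  obtain ⟨a, ha, b, hb, rfl⟩ := Finset.mem_add.1 (support_mul F G hm)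
  rw [map_add]
  exact add_le_add (hF a ha) (hG b hb)

theorem WeightLE.sum {ι : Type*} {s : Finset ι} {F : ι → MvPolynomial σ k} {t : ℚ}
    (h : ∀ i ∈ s, WeightLE w (F i) t) : WeightLE w (∑ i ∈ s, F i) t := by
  classical
  intro m hm
  obtain ⟨i, hi, hm⟩ := Finset.mem_biUnion.1 (support_sum hm)
  exact h i hi m hm

theorem weightedHomogeneousComponent_mul_of_weightLE {F G : MvPolynomial σ k} {s t : ℚ}
    (hF : WeightLE w F s) (hG : WeightLE w G t) :
    weightedHomogeneousComponent w (s + t) (F * G) =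
      weightedHomogeneousComponent w s F * weightedHomogeneousComponent w t G := by
  classical
  ext m
  rw [coeff_weightedHomogeneousComponent, coeff_mul, coeff_mul]
  split_ifs with h
  · refine Finset.sum_congr rfl fun x hx => ?_
    rw [coeff_weightedHomogeneousComponent, coeff_weightedHomogeneousComponent]
    by_cases h1 : coeff x.1 F = 0
    · simp [h1]
    by_cases h2 : coeff x.2 G = 0
    · simp [h2]
    have e1 := hF _ (mem_support_iff.2 h1)
    have e2 := hG _ (mem_support_iff.2 h2)
    rw [← Finset.HasAntidiagonal.mem_antidiagonal.1 hx, map_add] at h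
    rw [if_pos (by linarith), if_pos (by linarith)]
  · refine (Finset.sum_eq_zero fun x hx => ?_).symm
    rw [coeff_weightedHomogeneousComponent, coeff_weightedHomogeneousComponent]
    rw [← Finset.HasAntidiagonal.mem_antidiagonal.1 hx, map_add] at h
    split_ifs with h1 h2
    · exact absurd (by rw [h1, h2]) h
    all_goals simp

theorem weightedHomogeneousComponent_mul_of_left {H : MvPolynomial σ k} {s : ℚ}
    (hH : IsWeightedHomogeneous w H s) (R : MvPolynomial σ k) (t : ℚ) :
    weightedHomogeneousComponent w (s + t) (H * R) = H * weightedHomogeneousComponent w t R := by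
  classical
  induction R using MvPolynomial.induction_on' with
  | add p q hp hq => rw [mul_add, map_add, hp, hq, map_add, mul_add]
  | monomial m c =>
    have hm : IsWeightedHomogeneous w (monomial m c) (Finsupp.weight w m) :=
      isWeightedHomogeneous_monomial w m c rfl
    rw [weightedHomogeneousComponent_of_mem (hH.mul hm), weightedHomogeneousComponent_of_mem hm]
    simp only [add_right_inj]
    split_ifs <;> simp

theorem weightedHomogeneousComponent_eq_zero_of_lt {F : MvPolynomial σ k} {t : ℚ}
    (h : ∀ m ∈ F.support, Finsupp.weight w m < t) : weightedHomogeneousComponent w t F = 0 := by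
  classical
  ext m
  rw [coeff_weightedHomogeneousComponent, coeff_zero]
  split_ifs with hm
  · by_contra h0
    exact (h m (mem_support_iff.2 h0)).ne hm
  · rfl

theorem weight_lt_of_mem_support_sub_component {F : MvPolynomial σ k} {t : ℚ}
    (h : WeightLE w F t) :
    ∀ m ∈ (F - weightedHomogeneousComponent w t F).support, Finsupp.weight w m < t := by
  classical
  intro m hm
  rw [mem_support_iff, coeff_sub, coeff_weightedHomogeneousComponent] at hm
  by_cases hw : Finsupp.weight w m = t
  · simp [hw] at hm
  · rw [if_neg hw, sub_zero] at hm
    exact lt_of_le_of_ne (h m (mem_support_iff.2 hm)) hw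

end Weights

/-! ### Hasse derivatives along a coordinate and leading Taylor expansions. -/

section HasseDeriv

variable {σ : Type*} {k : Type*} [Field k] {R : Type*} [CommRing R] [Algebra k R]
  (E : MvPolynomial σ k ≃ₐ[k] Polynomial R)

/-- The Hasse derivatives with respect to a coordinate. -/
noncomputable def coordDeriv (i : ℕ) : MvPolynomial σ k →ₗ[k] MvPolynomial σ k :=
  E.symm.toLinearMap ∘ₗ ((Polynomial.hasseDeriv i).restrictScalars k) ∘ₗ E.toLinearMap

theorem coordDeriv_apply (i : ℕ) (F : MvPolynomial σ k) :
    coordDeriv E i F = E.symm (Polynomial.hasseDeriv i (E F)) := rfl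

theorem coordDeriv_zero (F : MvPolynomial σ k) : coordDeriv E 0 F = F := by
  rw [coordDeriv_apply, Polynomial.hasseDeriv_zero', AlgEquiv.symm_apply_apply]

theorem coordDeriv_mul (i : ℕ) (F G : MvPolynomial σ k) :
    coordDeriv E i (F * G) =
      ∑ x ∈ Finset.HasAntidiagonal.antidiagonal i, coordDeriv E x.1 F * coordDeriv E x.2 G := by
  simp only [coordDeriv_apply, map_mul, Polynomial.hasseDeriv_mul, map_sum]

theorem coordDeriv_coordDeriv (i j : ℕ) (F : MvPolynomial σ k) :
    coordDeriv E i (coordDeriv E j F) = ((i + j).choose i : k) • coordDeriv E (i + j) F := by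
  rw [coordDeriv_apply, coordDeriv_apply, AlgEquiv.apply_symm_apply, ← LinearMap.comp_apply,
    Polynomial.hasseDeriv_comp, LinearMap.smul_apply, coordDeriv_apply, Nat.cast_smul_eq_nsmul,
    map_nsmul]

theorem coordDeriv_eq_zero_of_lt {i : ℕ} {F : MvPolynomial σ k} (h : (E F).natDegree < i) :
    coordDeriv E i F = 0 := by
  rw [coordDeriv_apply, Polynomial.hasseDeriv_eq_zero_of_lt_natDegree _ _ h, map_zero]

theorem coordDeriv_C {i : ℕ} (hi : 0 < i) (c : k) : coordDeriv E i (C c) = 0 := by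
  refine coordDeriv_eq_zero_of_lt E ?_
  have : E (C c) = algebraMap k (Polynomial R) c := E.commutes c
  rw [this, Polynomial.algebraMap_apply, Polynomial.natDegree_C]
  exact hi

/-- If all positive derivatives killed the variables, the Leibniz rule would make them kill
everything, including the coordinate itself. -/
theorem exists_coordDeriv_X_ne_zero [Nontrivial R] : ∃ i, 0 < i ∧ ∃ j, coordDeriv E i (X j) ≠ 0 := by
  by_contra! h
  have hz : ∀ (F : MvPolynomial σ k) i, 0 < i → coordDeriv E i F = 0 := by
    intro F
    induction F using MvPolynomial.induction_on with
    | C a => exact fun i hi => coordDeriv_C E hi a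
    | add p q hp hq => exact fun i hi => by rw [map_add, hp i hi, hq i hi, add_zero]
    | mul_X p j hp =>
      intro i hi
      rw [coordDeriv_mul]
      refine Finset.sum_eq_zero fun x hx => ?_
      have := Finset.HasAntidiagonal.mem_antidiagonal.1 hx
      rcases Nat.eq_zero_or_pos x.1 with h1 | h1
      · rw [h x.2 (by omega), mul_zero]
      · rw [hp _ h1, zero_mul]
  have := hz (E.symm Polynomial.X) 1 one_pos
  rw [coordDeriv_apply, AlgEquiv.apply_symm_apply, Polynomial.hasseDeriv_one,
    Polynomial.derivative_X, map_one] at this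
  exact one_ne_zero this

/-- The slope `τ` bounds the weights of the derivatives of the variables. -/
def SlopeBound (w : σ → ℚ) (τ : ℚ) : Prop :=
  ∀ (i : ℕ) j, WeightLE w (coordDeriv E i (X j)) (w j + i * τ)

/-- `τ` is the largest value of `(weight m - w j) / i` over the monomials `m` of the derivatives of
order `i > 0` of the variables. That it is attained later makes some leading expansion nonconstant.
-/
theorem exists_slopeBound [Finite σ] [Nontrivial R] (w : σ → ℚ) :
    ∃ τ, SlopeBound E w τ ∧ ∃ i : ℕ, 0 < i ∧ ∃ j,
      weightedHomogeneousComponent w (w j + i * τ) (coordDeriv E i (X j)) ≠ 0 := by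
  classical
  cases nonempty_fintype σ
  let Ω : Finset (Σ _ : ℕ × σ, σ →₀ ℕ) :=
    ((Finset.range (Finset.univ.sup (fun j => (E (X j)).natDegree) + 1)).filter (0 < ·) ×ˢ
      Finset.univ).sigma fun x => (coordDeriv E x.1 (X x.2)).support
  have hΩ : ∀ i j m, 0 < i → m ∈ (coordDeriv E i (X j)).support → ⟨(i, j), m⟩ ∈ Ω := by
    intro i j m hi hm
    refine Finset.mem_sigma.2 ⟨Finset.mem_product.2 ⟨Finset.mem_filter.2 ⟨?_, hi⟩,
      Finset.mem_univ _⟩, hm⟩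
    rw [Finset.mem_range, Nat.lt_succ_iff]
    by_contra! h
    rw [coordDeriv_eq_zero_of_lt E (lt_of_le_of_lt
      (Finset.le_sup (f := fun j => (E (X j)).natDegree) (Finset.mem_univ j)) h)] at hm
    simp at hm
  obtain ⟨i, hi, j, hij⟩ := exists_coordDeriv_X_ne_zero E
  obtain ⟨m, hm⟩ := support_nonempty.2 hij
  obtain ⟨⟨⟨i₀, j₀⟩, m₀⟩, h₀, hmax⟩ := Ω.exists_max_image
    (fun x => (Finsupp.weight w x.2 - w x.1.2) / x.1.1) ⟨_, hΩ i j m hi hm⟩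
  simp only at hmax
  have h₀' := Finset.mem_sigma.1 h₀
  have hi₀ : 0 < i₀ := (Finset.mem_filter.1 (Finset.mem_product.1 h₀'.1).1).2
  refine ⟨(Finsupp.weight w m₀ - w j₀) / i₀, fun i j m hm => ?_, i₀, hi₀, j₀, fun h => ?_⟩
  · rcases Nat.eq_zero_or_pos i with rfl | hi
    · rw [coordDeriv_zero, support_X, Finset.mem_singleton] at hm
      rw [hm, Finsupp.weight_single]
      simp
    · have := hmax _ (hΩ i j m hi hm)
      simp only at this
      rw [div_le_iff₀ (by exact_mod_cast hi)] at this
      linarith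
  · have := congrArg (coeff m₀) h
    rw [coeff_weightedHomogeneousComponent, if_pos, coeff_zero] at this
    · exact mem_support_iff.1 h₀'.2 this
    · have : (i₀ : ℚ) ≠ 0 := by exact_mod_cast hi₀.ne'
      field_simp
      ring

variable {E} {w : σ → ℚ} {τ : ℚ}

theorem weightLE_coordDeriv_mul {F G : MvPolynomial σ k} {s t : ℚ}
    (hF : ∀ i : ℕ, WeightLE w (coordDeriv E i F) (s + i * τ))
    (hG : ∀ i : ℕ, WeightLE w (coordDeriv E i G) (t + i * τ)) (i : ℕ) :
    WeightLE w (coordDeriv E i (F * G)) (s + t + i * τ) := by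
  rw [coordDeriv_mul]
  refine WeightLE.sum fun x hx => ?_
  have hx := Finset.HasAntidiagonal.mem_antidiagonal.1 hx
  convert (hF x.1).mul (hG x.2) using 1
  rw [← hx]
  push_cast
  ring

theorem SlopeBound.weightLE_monomial (h : SlopeBound E w τ) (m : σ →₀ ℕ) (c : k) (i : ℕ) :
    WeightLE w (coordDeriv E i (monomial m c)) (Finsupp.weight w m + i * τ) := by
  have hC : ∀ (c : k) (i : ℕ), WeightLE w (coordDeriv E i (C c)) (0 + i * τ) := by
    intro c i
    rcases Nat.eq_zero_or_pos i with rfl | hi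
    · rw [coordDeriv_zero]
      simpa using weightLE_of_isWeightedHomogeneous (isWeightedHomogeneous_C w c)
    · rw [coordDeriv_C E hi]
      intro m hm
      simp at hm
  have hpow : ∀ (j : σ) (n i : ℕ), WeightLE w (coordDeriv E i (X j ^ n)) (n * w j + i * τ) := by
    intro j n
    induction n with
    | zero => simpa using hC 1
    | succ n ih =>
      intro i
      rw [pow_succ, Nat.cast_succ, add_mul, one_mul]
      exact weightLE_coordDeriv_mul ih (fun i => h i j) i
  induction m using Finsupp.induction_linear generalizing c i with
  | zero => simpa using hC c i
  | add m m' hm hm' =>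
    rw [map_add, ← mul_one c, ← monomial_mul]
    exact weightLE_coordDeriv_mul (hm c) (hm' 1) i
  | single j n =>
    rw [← C_mul_X_pow_eq_monomial, Finsupp.weight_single, nsmul_eq_mul]
    have := weightLE_coordDeriv_mul (hC c) (hpow j n) i
    rwa [zero_add] at this

theorem SlopeBound.exists_mem_support (h : SlopeBound E w τ) {F : MvPolynomial σ k} {i : ℕ}
    {m : σ →₀ ℕ} (hm : m ∈ (coordDeriv E i F).support) :
    ∃ m' ∈ F.support, Finsupp.weight w m ≤ Finsupp.weight w m' + i * τ := by
  classical
  rw [F.as_sum, map_sum] at hm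
  obtain ⟨m', hm', hm⟩ := Finset.mem_biUnion.1 (support_sum hm)
  exact ⟨m', hm', h.weightLE_monomial m' _ i m hm⟩

theorem SlopeBound.weightLE (h : SlopeBound E w τ) {F : MvPolynomial σ k} {t : ℚ}
    (hF : WeightLE w F t) (i : ℕ) : WeightLE w (coordDeriv E i F) (t + i * τ) := by
  intro m hm
  obtain ⟨m', hm', hle⟩ := h.exists_mem_support hm
  have := hF m' hm'
  linarith

theorem SlopeBound.component_eq_zero (h : SlopeBound E w τ) {F : MvPolynomial σ k} {t : ℚ}
    (hF : ∀ m ∈ F.support, Finsupp.weight w m < t) (i : ℕ) :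
    weightedHomogeneousComponent w (t + i * τ) (coordDeriv E i F) = 0 := by
  refine weightedHomogeneousComponent_eq_zero_of_lt fun m hm => ?_
  obtain ⟨m', hm', hle⟩ := h.exists_mem_support hm
  have := hF m' hm'
  linarith

variable (E w τ)

/-- The leading form of the Taylor expansion of `F` along a coordinate, for `F` of weight at most
`t` and when the parameter has weight `-τ`. -/
noncomputable def leadTaylor (F : MvPolynomial σ k) (t : ℚ) : Polynomial (MvPolynomial σ k) :=
  ∑ i ∈ Finset.range ((E F).natDegree + 1),
    Polynomial.monomial i (weightedHomogeneousComponent w (t + i * τ) (coordDeriv E i F))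

variable {E w τ}

theorem coeff_leadTaylor (F : MvPolynomial σ k) (t : ℚ) (i : ℕ) :
    (leadTaylor E w τ F t).coeff i =
      weightedHomogeneousComponent w (t + i * τ) (coordDeriv E i F) := by
  rw [leadTaylor, Polynomial.finsetSum_coeff]
  simp only [Polynomial.coeff_monomial, Finset.sum_ite_eq', Finset.mem_range]
  split_ifs with h
  · rfl
  · rw [coordDeriv_eq_zero_of_lt E (by omega), map_zero]

theorem leadTaylor_add (F G : MvPolynomial σ k) (t : ℚ) :
    leadTaylor E w τ (F + G) t = leadTaylor E w τ F t + leadTaylor E w τ G t := by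
  ext1 i
  simp only [Polynomial.coeff_add, coeff_leadTaylor, map_add]

theorem leadTaylor_sum {ι : Type*} (s : Finset ι) (F : ι → MvPolynomial σ k) (t : ℚ) :
    leadTaylor E w τ (∑ i ∈ s, F i) t = ∑ i ∈ s, leadTaylor E w τ (F i) t := by
  ext1 i
  simp only [Polynomial.finsetSum_coeff, coeff_leadTaylor, map_sum]

theorem leadTaylor_C_mul (c : k) (F : MvPolynomial σ k) (t : ℚ) :
    leadTaylor E w τ (C c * F) t = Polynomial.C (C c) * leadTaylor E w τ F t := by
  ext1 i
  simp only [Polynomial.coeff_C_mul, coeff_leadTaylor, ← smul_eq_C_mul, map_smul]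

theorem leadTaylor_sub (F G : MvPolynomial σ k) (t : ℚ) :
    leadTaylor E w τ (F - G) t = leadTaylor E w τ F t - leadTaylor E w τ G t := by
  ext1 i
  simp only [Polynomial.coeff_sub, coeff_leadTaylor, map_sub]

theorem coeff_zero_leadTaylor (F : MvPolynomial σ k) (t : ℚ) :
    (leadTaylor E w τ F t).coeff 0 = weightedHomogeneousComponent w t F := by
  rw [coeff_leadTaylor, coordDeriv_zero, Nat.cast_zero, zero_mul, add_zero]

theorem leadTaylor_ne_zero {F : MvPolynomial σ k} {t : ℚ} (hF : IsWeightedHomogeneous w F t)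
    (h0 : F ≠ 0) : leadTaylor E w τ F t ≠ 0 := by
  intro h
  have := coeff_zero_leadTaylor (E := E) (w := w) (τ := τ) F t
  rw [h, Polynomial.coeff_zero, hF.weightedHomogeneousComponent_same] at this
  exact h0 this.symm

/-- The Leibniz rule, combined with multiplicativity of top components. Degrees in the parameter
hence add up. -/
theorem SlopeBound.leadTaylor_mul (h : SlopeBound E w τ) {F G : MvPolynomial σ k} {s t : ℚ}
    (hF : WeightLE w F s) (hG : WeightLE w G t) :
    leadTaylor E w τ (F * G) (s + t) = leadTaylor E w τ F s * leadTaylor E w τ G t := by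
  ext1 i
  rw [Polynomial.coeff_mul, coeff_leadTaylor, coordDeriv_mul, map_sum]
  refine Finset.sum_congr rfl fun x hx => ?_
  rw [coeff_leadTaylor, coeff_leadTaylor,
    ← weightedHomogeneousComponent_mul_of_weightLE (h.weightLE hF x.1) (h.weightLE hG x.2),
    ← Finset.HasAntidiagonal.mem_antidiagonal.1 hx]
  congr 1
  push_cast
  ring_nf

/-- Terms of weight below `t` have derivatives of too small a weight to contribute. -/
theorem SlopeBound.leadTaylor_component (h : SlopeBound E w τ) {F : MvPolynomial σ k} {t : ℚ}
    (hF : WeightLE w F t) :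
    leadTaylor E w τ (weightedHomogeneousComponent w t F) t = leadTaylor E w τ F t := by
  rw [eq_comm, ← sub_eq_zero, ← leadTaylor_sub]
  ext1 i
  rw [coeff_leadTaylor, h.component_eq_zero (weight_lt_of_mem_support_sub_component hF),
    Polynomial.coeff_zero]

theorem SlopeBound.coeff_leadTaylor_coeff (h : SlopeBound E w τ) {F : MvPolynomial σ k} {t : ℚ}
    (hF : WeightLE w F t) (i r : ℕ) :
    (leadTaylor E w τ ((leadTaylor E w τ F t).coeff i) (t + i * τ)).coeff r =
      ((r + i).choose r : k) • (leadTaylor E w τ F t).coeff (r + i) := by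
  rw [coeff_leadTaylor F, h.leadTaylor_component (h.weightLE hF i), coeff_leadTaylor,
    coordDeriv_coordDeriv, map_smul, coeff_leadTaylor]
  congr 3
  push_cast
  ring

variable (E w τ)

/-- The degrees in the parameter of the leading Taylor expansions of homogeneous elements. -/
def taylorDegrees : Set ℕ :=
  {d | ∃ F t, IsWeightedHomogeneous w F t ∧ F ≠ 0 ∧ (leadTaylor E w τ F t).natDegree = d}

variable {E w τ}

/-- The coefficient of order `d - r` in an expansion of degree `d` is homogeneous. Its own expansion
has degree `r`: the coefficient of order `r` is `d.choose r` times the leading one, and those beyond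
come from orders above `d`. -/
theorem SlopeBound.mem_taylorDegrees_of_choose_ne_zero (h : SlopeBound E w τ) :
    ∀ d ∈ taylorDegrees E w τ, ∀ r ≤ d, (d.choose r : k) ≠ 0 → r ∈ taylorDegrees E w τ := by
  rintro d ⟨F, t, hF, hF0, rfl⟩ r hr hc
  set d := (leadTaylor E w τ F t).natDegree with hd
  have hlead : (leadTaylor E w τ F t).coeff d ≠ 0 := by
    rw [hd, Polynomial.coeff_natDegree, Polynomial.leadingCoeff_ne_zero]
    exact leadTaylor_ne_zero hF hF0
  have hr' : (leadTaylor E w τ ((leadTaylor E w τ F t).coeff (d - r))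
      (t + (d - r : ℕ) * τ)).coeff r ≠ 0 := by
    rw [h.coeff_leadTaylor_coeff (weightLE_of_isWeightedHomogeneous hF), Nat.add_sub_cancel' hr]
    exact smul_ne_zero hc hlead
  refine ⟨(leadTaylor E w τ F t).coeff (d - r), t + (d - r : ℕ) * τ, ?_, ?_, ?_⟩
  · rw [coeff_leadTaylor]
    exact weightedHomogeneousComponent_isWeightedHomogeneous _ _
  · intro h0
    rw [h0] at hr'
    refine hr' ?_
    rw [coeff_leadTaylor, map_zero, map_zero]
  · refine le_antisymm (Polynomial.natDegree_le_iff_coeff_eq_zero.2 fun r' hlt => ?_)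
      (Polynomial.le_natDegree_of_ne_zero hr')
    rw [h.coeff_leadTaylor_coeff (weightLE_of_isWeightedHomogeneous hF),
      Polynomial.coeff_eq_zero_of_natDegree_lt (by omega),
      smul_zero]

end HasseDeriv

/-! ### Leading expansions of constants and powers. -/

section LeadTaylorMonomial

variable {σ : Type*} {k : Type*} [Field k] {R : Type*} [CommRing R] [Algebra k R]
  {E : MvPolynomial σ k ≃ₐ[k] Polynomial R} {w : σ → ℚ} {τ : ℚ}

theorem leadTaylor_C (c : k) : leadTaylor E w τ (C c) 0 = Polynomial.C (C c) := by
  ext1 i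
  rcases Nat.eq_zero_or_pos i with rfl | hi
  · rw [coeff_zero_leadTaylor, Polynomial.coeff_C_zero,
      (isWeightedHomogeneous_C w c).weightedHomogeneousComponent_same]
  · rw [coeff_leadTaylor, coordDeriv_C E hi, map_zero, Polynomial.coeff_C_of_ne_zero hi.ne']

theorem SlopeBound.leadTaylor_pow (h : SlopeBound E w τ) {F : MvPolynomial σ k} {t : ℚ}
    (hF : IsWeightedHomogeneous w F t) (n : ℕ) :
    leadTaylor E w τ (F ^ n) (n * t) = leadTaylor E w τ F t ^ n := by
  induction n with
  | zero => simpa using leadTaylor_C (E := E) (w := w) (τ := τ) 1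
  | succ n ih =>
    have hn := hF.pow n
    rw [nsmul_eq_mul] at hn
    rw [pow_succ, pow_succ, ← ih, ← h.leadTaylor_mul (weightLE_of_isWeightedHomogeneous hn)
      (weightLE_of_isWeightedHomogeneous hF)]
    congr 1
    push_cast
    ring

theorem natDegree_leadTaylor_eq_zero {F : MvPolynomial σ k} (hF : (E F).natDegree = 0) (t : ℚ) :
    (leadTaylor E w τ F t).natDegree = 0 := by
  refine Nat.le_zero.1 (Polynomial.natDegree_le_iff_coeff_eq_zero.2 fun i hi => ?_)
  rw [coeff_leadTaylor, coordDeriv_eq_zero_of_lt E (by omega), map_zero]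

end LeadTaylorMonomial

/-! ### Weighted forms in two variables vanishing at a point of the torus. -/

section Plane

variable {k : Type*} [Field k]

/-- The weights `b` of the first and `a` of the second variable. -/
def planeWeight (a b : ℕ) : Fin 2 → ℚ := ![b, a]

theorem weight_planeWeight (a b : ℕ) (m : Fin 2 →₀ ℕ) :
    Finsupp.weight (planeWeight a b) m = ((b * m 0 + a * m 1 : ℕ) : ℚ) := by
  rw [Finsupp.weight_apply, Finsupp.sum_fintype _ _ (by simp), Fin.sum_univ_two]
  simp [planeWeight, mul_comm]

theorem monomial_fin_two (m : Fin 2 →₀ ℕ) (c : k) :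
    monomial m c = C c * (X 0 ^ m 0 * X 1 ^ m 1) := by
  rw [monomial_eq, Finsupp.prod_fintype _ _ (by simp), Fin.prod_univ_two]

theorem eval_monomial_fin_two (α β c : k) (m : Fin 2 →₀ ℕ) :
    eval ![α, β] (monomial m c) = c * (α ^ m 0 * β ^ m 1) := by
  rw [monomial_fin_two]
  simp

/-- As `a` and `b` are coprime, monomials of equal weight differ by trading `x₀ ^ (a t)` for `x₁ ^
(b t)`, and modulo the binomial this only costs a factor `c ^ t`. -/
theorem dvd_smul_monomial_sub {a b : ℕ} (ha : 0 < a) (hab : a.Coprime b) {α β c : k}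
    (hc : α ^ a = c * β ^ b) {m m' : Fin 2 →₀ ℕ} (hm : b * m 0 + a * m 1 = b * m' 0 + a * m' 1) :
    (X 0 ^ a - C c * X 1 ^ b : MvPolynomial (Fin 2) k) ∣
      C (α ^ m' 0 * β ^ m' 1) * (X 0 ^ m 0 * X 1 ^ m 1) -
        C (α ^ m 0 * β ^ m 1) * (X 0 ^ m' 0 * X 1 ^ m' 1) := by
  wlog hle : m' 0 ≤ m 0 generalizing m m'
  · have := this hm.symm (by omega)
    rwa [← dvd_neg, neg_sub] at this
  obtain ⟨s, hs⟩ := Nat.exists_eq_add_of_le hle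
  have h1 : a * m' 1 = a * m 1 + b * s := by
    rw [hs, mul_add] at hm
    omega
  obtain ⟨t, rfl⟩ : a ∣ s := by
    refine hab.dvd_of_dvd_mul_left ?_
    exact (Nat.dvd_add_right (dvd_mul_right a (m 1))).1 ⟨m' 1, h1.symm⟩
  have h2 : m' 1 = m 1 + b * t := Nat.eq_of_mul_eq_mul_left ha (by rw [h1]; ring)
  have key : (X 0 ^ a - C c * X 1 ^ b : MvPolynomial (Fin 2) k) ∣
      (X 0 ^ a) ^ t - (C c * X 1 ^ b) ^ t := sub_dvd_pow_sub_pow _ _ _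
  have hα : α ^ (a * t) = c ^ t * β ^ (b * t) := by rw [pow_mul, hc, mul_pow, pow_mul]
  convert key.mul_left (C (α ^ m' 0 * β ^ (m 1 + b * t)) * (X 0 ^ m' 0 * X 1 ^ m 1)) using 1
  rw [hs, h2, pow_add α, hα]
  simp only [C_mul, C_pow]
  ring

/-- Modulo the binomial, a weighted form is determined by its value at `(α, β)`; if this value is
zero, the binomial divides the form. -/
theorem dvd_smul_sub_eval_smul {a b : ℕ} (ha : 0 < a) (hab : a.Coprime b) {α β c : k}
    (hc : α ^ a = c * β ^ b) {F : MvPolynomial (Fin 2) k} {m' : Fin 2 →₀ ℕ}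
    (hF : IsWeightedHomogeneous (planeWeight a b) F (Finsupp.weight (planeWeight a b) m')) :
    (X 0 ^ a - C c * X 1 ^ b : MvPolynomial (Fin 2) k) ∣
      C (α ^ m' 0 * β ^ m' 1) * F - C (eval ![α, β] F) * (X 0 ^ m' 0 * X 1 ^ m' 1) := by
  have h1 : C (α ^ m' 0 * β ^ m' 1) * F = ∑ m ∈ F.support,
      C (coeff m F) * (C (α ^ m' 0 * β ^ m' 1) * (X 0 ^ m 0 * X 1 ^ m 1)) := by
    conv_lhs => rw [F.as_sum, Finset.mul_sum]
    refine Finset.sum_congr rfl fun m _ => ?_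
    rw [monomial_fin_two]
    ring
  have h2 : (C (eval ![α, β] F) : MvPolynomial (Fin 2) k) =
      ∑ m ∈ F.support, C (coeff m F) * C (α ^ m 0 * β ^ m 1) := by
    conv_lhs => rw [F.as_sum]
    rw [map_sum, map_sum]
    refine Finset.sum_congr rfl fun m _ => ?_
    rw [eval_monomial_fin_two, C_mul]
  rw [h1, h2, Finset.sum_mul, ← Finset.sum_sub_distrib]
  refine Finset.dvd_sum fun m hm => ?_
  rw [mul_assoc, ← mul_sub]
  refine (dvd_smul_monomial_sub ha hab hc ?_).mul_left _
  have := hF (mem_support_iff.1 hm)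
  rw [weight_planeWeight, weight_planeWeight] at this
  exact_mod_cast this

theorem isWeightedHomogeneous_pow_sub_pow (a b : ℕ) (c : k) :
    IsWeightedHomogeneous (planeWeight a b) (X 0 ^ a - C c * X 1 ^ b : MvPolynomial (Fin 2) k)
      ((a * b : ℕ) : ℚ) := by
  have h0 := (isWeightedHomogeneous_X k (planeWeight a b) 0).pow a
  have h1 := ((isWeightedHomogeneous_X k (planeWeight a b) 1).pow b).C_mul c
  have e0 : a • planeWeight a b 0 = ((a * b : ℕ) : ℚ) := by simp [planeWeight]
  have e1 : b • planeWeight a b 1 = ((a * b : ℕ) : ℚ) := by simp [planeWeight, mul_comm]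
  rw [e0] at h0
  rw [e1] at h1
  exact h0.sub h1

theorem exists_nat_weight {a b : ℕ} {F : MvPolynomial (Fin 2) k} {t : ℚ}
    (hF : IsWeightedHomogeneous (planeWeight a b) F t) (h0 : F ≠ 0) :
    ∃ m : Fin 2 →₀ ℕ, t = Finsupp.weight (planeWeight a b) m := by
  obtain ⟨m, hm⟩ := support_nonempty.2 h0
  exact ⟨m, (hF (mem_support_iff.1 hm)).symm⟩

theorem exists_homogeneous_factor {a b : ℕ} (ha : 0 < a) (hab : a.Coprime b) {α β c : k}
    (hα : α ≠ 0) (hβ : β ≠ 0) (hc : α ^ a = c * β ^ b) {F : MvPolynomial (Fin 2) k} {t : ℚ}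
    (hF : IsWeightedHomogeneous (planeWeight a b) F t) (hev : eval ![α, β] F = 0) :
    ∃ G, IsWeightedHomogeneous (planeWeight a b) G (t - (a * b : ℕ)) ∧
      F = (X 0 ^ a - C c * X 1 ^ b) * G := by
  by_cases h0 : F = 0
  · exact ⟨0, isWeightedHomogeneous_zero _ _ _, by rw [h0, mul_zero]⟩
  obtain ⟨m, rfl⟩ := exists_nat_weight hF h0
  have h := dvd_smul_sub_eval_smul ha hab hc hF
  rw [hev, C_0, zero_mul, sub_zero] at h
  have hu : IsUnit (C (α ^ m 0 * β ^ m 1) : MvPolynomial (Fin 2) k) :=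
    (IsUnit.mk0 _ (mul_ne_zero (pow_ne_zero _ hα) (pow_ne_zero _ hβ))).map C
  obtain ⟨G, hG⟩ := hu.dvd_mul_left.1 h
  refine ⟨_, weightedHomogeneousComponent_isWeightedHomogeneous _ G, ?_⟩
  rw [← weightedHomogeneousComponent_mul_of_left (isWeightedHomogeneous_pow_sub_pow a b c), ← hG,
    add_sub_cancel, hF.weightedHomogeneousComponent_same]

variable {R : Type*} [CommRing R] [Algebra k R] {E : MvPolynomial (Fin 2) k ≃ₐ[k] Polynomial R}
  {a b : ℕ} {τ : ℚ}

theorem leadTaylor_monomial_plane (h : SlopeBound E (planeWeight a b) τ) (m : Fin 2 →₀ ℕ) (c : k) :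
    leadTaylor E (planeWeight a b) τ (monomial m c) ((b * m 0 + a * m 1 : ℕ) : ℚ) =
      Polynomial.C (C c) * (leadTaylor E (planeWeight a b) τ (X 0) b ^ m 0 *
        leadTaylor E (planeWeight a b) τ (X 1) a ^ m 1) := by
  have hX0 : IsWeightedHomogeneous (planeWeight a b) (X 0 : MvPolynomial (Fin 2) k) (b : ℚ) :=
    isWeightedHomogeneous_X k (planeWeight a b) 0
  have hX1 : IsWeightedHomogeneous (planeWeight a b) (X 1 : MvPolynomial (Fin 2) k) (a : ℚ) :=
    isWeightedHomogeneous_X k (planeWeight a b) 1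
  have h0 := hX0.pow (m 0)
  have h1 := hX1.pow (m 1)
  rw [nsmul_eq_mul] at h0 h1
  rw [monomial_fin_two, leadTaylor_C_mul, ← h.leadTaylor_pow hX0, ← h.leadTaylor_pow hX1,
    ← h.leadTaylor_mul (weightLE_of_isWeightedHomogeneous h0)
      (weightLE_of_isWeightedHomogeneous h1)]
  congr 2
  push_cast
  ring

theorem natDegree_leadTaylor_le (h : SlopeBound E (planeWeight a b) τ) {e : ℕ}
    (h0 : (leadTaylor E (planeWeight a b) τ (X 0) b).natDegree = b * e)
    (h1 : (leadTaylor E (planeWeight a b) τ (X 1) a).natDegree = a * e)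
    {F : MvPolynomial (Fin 2) k} {N : ℕ}
    (hF : IsWeightedHomogeneous (planeWeight a b) F (N : ℚ)) :
    (leadTaylor E (planeWeight a b) τ F N).natDegree ≤ N * e := by
  conv_lhs => rw [F.as_sum, leadTaylor_sum]
  refine Polynomial.natDegree_sum_le_of_forall_le _ _ fun m hm => ?_
  have hN := hF (mem_support_iff.1 hm)
  rw [weight_planeWeight] at hN
  rw [← hN, leadTaylor_monomial_plane h, ← show b * m 0 + a * m 1 = N by exact_mod_cast hN]
  refine (Polynomial.natDegree_C_mul_le _ _).trans (Polynomial.natDegree_mul_le.trans ?_)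
  rw [Polynomial.natDegree_pow, Polynomial.natDegree_pow, h0, h1]
  exact le_of_eq (by ring)

/-- A form vanishing at `(α, β)` loses a factor of degree zero in the parameter, and induction
applies. Any other form is a monomial, of degree exactly `N * e`, plus a multiple of the binomial,
of smaller degree. -/
theorem natDegree_leadTaylor_eq_zero_or_le (h : SlopeBound E (planeWeight a b) τ) (ha : 0 < a)
    (hb : 0 < b) (hab : a.Coprime b) {α β c : k} (hα : α ≠ 0) (hβ : β ≠ 0)
    (hc : α ^ a = c * β ^ b) {e : ℕ}
    (h0 : (leadTaylor E (planeWeight a b) τ (X 0) b).natDegree = b * e)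
    (h1 : (leadTaylor E (planeWeight a b) τ (X 1) a).natDegree = a * e)
    (he : 0 < e)
    (hh : (leadTaylor E (planeWeight a b) τ (X 0 ^ a - C c * X 1 ^ b) (a * b : ℕ)).natDegree = 0)
    (N : ℕ) {F : MvPolynomial (Fin 2) k}
    (hF : IsWeightedHomogeneous (planeWeight a b) F (N : ℚ)) (hF0 : F ≠ 0) :
    (leadTaylor E (planeWeight a b) τ F N).natDegree = 0 ∨
      min a b * e ≤ (leadTaylor E (planeWeight a b) τ F N).natDegree := by
  induction N using Nat.strong_induction_on generalizing F with
  | _ N ih =>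
  have hfac : ∀ {G : MvPolynomial (Fin 2) k} (_ : IsWeightedHomogeneous (planeWeight a b) G (N : ℚ))
      (_ : G ≠ 0) (_ : eval ![α, β] G = 0), ∃ (N' : ℕ) (G' : MvPolynomial (Fin 2) k),
        N = a * b + N' ∧ IsWeightedHomogeneous (planeWeight a b) G' (N' : ℚ) ∧ G' ≠ 0 ∧
        (leadTaylor E (planeWeight a b) τ G N).natDegree =
          (leadTaylor E (planeWeight a b) τ G' N').natDegree := by
    intro G hG hG0 hev
    obtain ⟨G', hG', hGG'⟩ := exists_homogeneous_factor ha hab hα hβ hc hG hev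
    have hG'0 : G' ≠ 0 := by
      rintro rfl
      exact hG0 (by rw [hGG', mul_zero])
    obtain ⟨m, hm⟩ := exists_nat_weight hG' hG'0
    rw [weight_planeWeight] at hm
    have hN : (N : ℚ) = (a * b : ℕ) + ((b * m 0 + a * m 1 : ℕ) : ℚ) := by linarith
    rw [hm] at hG'
    refine ⟨_, G', by exact_mod_cast hN, hG', hG'0, ?_⟩
    have hhom := isWeightedHomogeneous_pow_sub_pow a b c
    have hne : (X 0 ^ a - C c * X 1 ^ b : MvPolynomial (Fin 2) k) ≠ 0 := by
      intro h
      exact hG0 (by rw [hGG', h, zero_mul])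
    rw [hN, hGG', h.leadTaylor_mul (weightLE_of_isWeightedHomogeneous hhom)
      (weightLE_of_isWeightedHomogeneous hG'),
      Polynomial.natDegree_mul (leadTaylor_ne_zero hhom hne) (leadTaylor_ne_zero hG' hG'0), hh,
      zero_add]
  by_cases hev : eval ![α, β] F = 0
  · obtain ⟨N', G, hN, hG, hG0, hdeg⟩ := hfac hF hF0 hev
    rw [hdeg]
    exact ih N' (by have := Nat.mul_pos ha hb; omega) hG hG0
  · obtain ⟨m, hm⟩ := exists_nat_weight hF hF0
    have hm' := hm
    rw [weight_planeWeight] at hm'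
    have hNm : N = b * m 0 + a * m 1 := by exact_mod_cast hm'
    set δ := eval ![α, β] F / (α ^ m 0 * β ^ m 1) with hδ
    have hαβ : α ^ m 0 * β ^ m 1 ≠ 0 := mul_ne_zero (pow_ne_zero _ hα) (pow_ne_zero _ hβ)
    have hδ0 : δ ≠ 0 := div_ne_zero hev hαβ
    have hmon : IsWeightedHomogeneous (planeWeight a b) (monomial m δ) (N : ℚ) :=
      isWeightedHomogeneous_monomial _ _ _ hm.symm
    have hdm : (leadTaylor E (planeWeight a b) τ (monomial m δ) N).natDegree = N * e := by
      have hC : (C δ : MvPolynomial (Fin 2) k) ≠ 0 := by rwa [Ne, C_eq_zero]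
      have hX0 := leadTaylor_ne_zero (E := E) (τ := τ)
        (isWeightedHomogeneous_X k (planeWeight a b) 0) (X_ne_zero 0)
      have hX1 := leadTaylor_ne_zero (E := E) (τ := τ)
        (isWeightedHomogeneous_X k (planeWeight a b) 1) (X_ne_zero 1)
      change leadTaylor E (planeWeight a b) τ (X 0) (b : ℚ) ≠ 0 at hX0
      change leadTaylor E (planeWeight a b) τ (X 1) (a : ℚ) ≠ 0 at hX1
      rw [hNm, leadTaylor_monomial_plane h, Polynomial.natDegree_C_mul hC,
        Polynomial.natDegree_mul (pow_ne_zero _ hX0) (pow_ne_zero _ hX1),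
        Polynomial.natDegree_pow, Polynomial.natDegree_pow, h0, h1]
      ring
    have hN0 : N = 0 ∨ min a b ≤ N := by
      rcases Nat.eq_zero_or_pos (m 0) with h0 | h0
      · rcases Nat.eq_zero_or_pos (m 1) with h1 | h1
        · exact Or.inl (by rw [hNm, h0, h1, mul_zero, mul_zero, add_zero])
        · exact Or.inr (by
            have := Nat.le_mul_of_pos_right a h1
            have := min_le_left a b
            omega)
      · exact Or.inr (by
            have := Nat.le_mul_of_pos_right b h0
            have := min_le_right a b
            omega)
    have hFdeg : (leadTaylor E (planeWeight a b) τ F N).natDegree = N * e := by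
      by_cases hG0 : F - monomial m δ = 0
      · rw [sub_eq_zero.1 hG0, hdm]
      have hGev : eval ![α, β] (F - monomial m δ) = 0 := by
        rw [map_sub, eval_monomial_fin_two, hδ, div_mul_cancel₀ _ hαβ, sub_self]
      obtain ⟨N', G', hN, hG', hG'0, hdeg⟩ := hfac (hF.sub hmon) hG0 hGev
      have hlt : (leadTaylor E (planeWeight a b) τ (F - monomial m δ) N).natDegree < N * e := by
        rw [hdeg]
        refine (natDegree_leadTaylor_le h h0 h1 hG').trans_lt ?_
        exact Nat.mul_lt_mul_of_pos_right (by have := Nat.mul_pos ha hb; omega) he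
      have : F = monomial m δ + (F - monomial m δ) := by ring
      rw [this, leadTaylor_add, Polynomial.natDegree_add_eq_left_of_natDegree_lt (by rwa [hdm]), hdm]
    rw [hFdeg]
    rcases hN0 with h | h
    · exact Or.inl (by rw [h, zero_mul])
    · exact Or.inr (Nat.mul_le_mul_right e h)

/-- The binomial divides the top form of `P`, whose expansion is constant in the parameter, so the
expansion of the binomial is constant too. The variables then have degrees `b * e` and `a * e`; the
least positive degree `min a b * e` divides both, so `min a b` divides the gcd of `a` and `b`. -/
theorem eq_one_or_eq_one_of_eval_component_eq_zero [Nontrivial R] (ha : 0 < a)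
    (hb : 0 < b) (hab : a.Coprime b) {α β : k} (hα : α ≠ 0) (hβ : β ≠ 0)
    {P : MvPolynomial (Fin 2) k} (hP : (E P).natDegree = 0) {t : ℚ}
    (hPt : WeightLE (planeWeight a b) P t)
    (hP0 : weightedHomogeneousComponent (planeWeight a b) t P ≠ 0)
    (hev : eval ![α, β] (weightedHomogeneousComponent (planeWeight a b) t P) = 0) :
    a = 1 ∨ b = 1 := by
  obtain ⟨τ, h, i, hi, j, hij⟩ := exists_slopeBound E (planeWeight a b)
  obtain ⟨c, hc⟩ : ∃ c, α ^ a = c * β ^ b :=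
    ⟨α ^ a / β ^ b, (div_mul_cancel₀ _ (pow_ne_zero _ hβ)).symm⟩
  set S := leadTaylor E (planeWeight a b) τ
  have hhom := isWeightedHomogeneous_pow_sub_pow a b c
  have hh : (S (X 0 ^ a - C c * X 1 ^ b) (a * b : ℕ)).natDegree = 0 := by
    have hPhom := weightedHomogeneousComponent_isWeightedHomogeneous (w := planeWeight a b) t P
    obtain ⟨G, hG, hPG⟩ := exists_homogeneous_factor ha hab hα hβ hc hPhom hev
    have hne : (X 0 ^ a - C c * X 1 ^ b : MvPolynomial (Fin 2) k) ≠ 0 := by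
      intro h
      exact hP0 (by rw [hPG, h, zero_mul])
    have hG0 : G ≠ 0 := by
      rintro rfl
      exact hP0 (by rw [hPG, mul_zero])
    have := natDegree_leadTaylor_eq_zero (w := planeWeight a b) (τ := τ) hP t
    rw [← h.leadTaylor_component hPt, hPG, ← add_sub_cancel ((a * b : ℕ) : ℚ) t,
      h.leadTaylor_mul (weightLE_of_isWeightedHomogeneous hhom)
      (weightLE_of_isWeightedHomogeneous hG),
      Polynomial.natDegree_mul (leadTaylor_ne_zero hhom hne) (leadTaylor_ne_zero hG hG0)] at this
    exact (Nat.add_eq_zero_iff.1 this).1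
  have hX0 : IsWeightedHomogeneous (planeWeight a b) (X 0 : MvPolynomial (Fin 2) k) (b : ℚ) :=
    isWeightedHomogeneous_X k (planeWeight a b) 0
  have hX1 : IsWeightedHomogeneous (planeWeight a b) (X 1 : MvPolynomial (Fin 2) k) (a : ℚ) :=
    isWeightedHomogeneous_X k (planeWeight a b) 1
  have hmul : a * (S (X 0) b).natDegree = b * (S (X 1) a).natDegree := by
    have hS : S (X 0 ^ a - C c * X 1 ^ b) (a * b : ℕ) =
        S (X 0) b ^ a - Polynomial.C (C c) * S (X 1) a ^ b := by
      simp only [S]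
      rw [leadTaylor_sub, leadTaylor_C_mul, ← h.leadTaylor_pow hX0, ← h.leadTaylor_pow hX1]
      push_cast
      rw [mul_comm (b : ℚ)]
    have hc0 : (C c : MvPolynomial (Fin 2) k) ≠ 0 := by
      rw [Ne, C_eq_zero]
      rintro rfl
      rw [zero_mul] at hc
      exact pow_ne_zero _ hα hc
    rw [hS] at hh
    -- If the degrees of the two terms of the binomial differed, the larger one would survive.
    rcases lt_trichotomy (a * (S (X 0) b).natDegree) (b * (S (X 1) a).natDegree) with hlt | heq | hlt
    · rw [Polynomial.natDegree_sub_eq_right_of_natDegree_lt, Polynomial.natDegree_C_mul hc0,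
        Polynomial.natDegree_pow] at hh
      · omega
      · rwa [Polynomial.natDegree_C_mul hc0, Polynomial.natDegree_pow, Polynomial.natDegree_pow]
    · exact heq
    · rw [Polynomial.natDegree_sub_eq_left_of_natDegree_lt, Polynomial.natDegree_pow] at hh
      · omega
      · rwa [Polynomial.natDegree_C_mul hc0, Polynomial.natDegree_pow, Polynomial.natDegree_pow]
  obtain ⟨e, h1⟩ : a ∣ (S (X 1) a).natDegree := hab.dvd_of_dvd_mul_left ⟨_, hmul.symm⟩
  have h0 : (S (X 0) b).natDegree = b * e := by
    refine Nat.eq_of_mul_eq_mul_left ha ?_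
    rw [hmul, h1]
    ring
  have hpos : ∃ j : Fin 2, 0 < (S (X j) (planeWeight a b j)).natDegree := by
    refine ⟨j, hi.trans_le (Polynomial.le_natDegree_of_ne_zero ?_)⟩
    rwa [coeff_leadTaylor]
  have he : 0 < e := by
    obtain ⟨j, hj⟩ := hpos
    refine Nat.pos_of_ne_zero fun he => ?_
    rw [he, mul_zero] at h0 h1
    fin_cases j
    · exact hj.ne' h0
    · exact hj.ne' h1
  have hmem0 : b * e ∈ taylorDegrees E (planeWeight a b) τ := ⟨_, _, hX0, X_ne_zero 0, h0⟩
  have hmem1 : a * e ∈ taylorDegrees E (planeWeight a b) τ := ⟨_, _, hX1, X_ne_zero 1, h1⟩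
  have hmin : ∀ d ∈ taylorDegrees E (planeWeight a b) τ, 0 < d → min a b * e ≤ d := by
    rintro d ⟨F, t, hF, hF0, rfl⟩ hd
    obtain ⟨m, rfl⟩ := exists_nat_weight hF hF0
    rw [weight_planeWeight] at hF hd ⊢
    exact (natDegree_leadTaylor_eq_zero_or_le h ha hb hab hα hβ hc h0 h1 he hh _ hF hF0).resolve_left
      hd.ne'
  have hq : min a b * e ∈ taylorDegrees E (planeWeight a b) τ := by
    rcases min_choice a b with h | h <;> rw [h] <;> assumption
  have hq0 : 0 < min a b * e := Nat.mul_pos (lt_min ha hb) he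
  have hda := dvd_of_choose_closed k h.mem_taylorDegrees_of_choose_ne_zero hq hq0 hmin hmem1
  have hdb := dvd_of_choose_closed k h.mem_taylorDegrees_of_choose_ne_zero hq hq0 hmin hmem0
  have h1 := Nat.dvd_gcd (Nat.dvd_of_mul_dvd_mul_right he hda)
    (Nat.dvd_of_mul_dvd_mul_right he hdb)
  rw [hab, Nat.dvd_one] at h1
  rcases min_choice a b with h | h
  · exact Or.inl (h ▸ h1)
  · exact Or.inr (h ▸ h1)

end Plane

/-! ### The theorem of Jung and van der Kulk. -/

section Tame

variable {k : Type*} [Field k]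

/-- The exchange of the two coordinates of the plane. -/
noncomputable def swapAut (k : Type*) [Field k] : PolyAut 2 k where
  val := ⟨![X 1, X 0]⟩
  inv := ⟨![X 1, X 0]⟩
  val_inv := by
    ext1
    funext i
    fin_cases i <;> simp [mul_comp, one_comp]
  inv_val := by
    ext1
    funext i
    fin_cases i <;> simp [mul_comp, one_comp]

theorem swapAut_comp_zero : (swapAut k : PolyEnd 2 k).comp 0 = X 1 := rfl

theorem swapAut_comp_one : (swapAut k : PolyEnd 2 k).comp 1 = X 0 := rfl

theorem swapAut_inv : (swapAut k)⁻¹ = swapAut k := rfl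

theorem swapAut_mem_tame : swapAut k ∈ Tame 2 k := by
  refine Subgroup.subset_closure (Or.inl ⟨!![0, 1; 1, 0], 0, ?_, fun i => ?_⟩)
  · simp [Matrix.det_fin_two]
  · fin_cases i
    · simp [swapAut_comp_zero]
    · simp [swapAut_comp_one]

theorem mem_tame_of_comp_one_eq_X {u : PolyAut 2 k} (h1 : (u : PolyEnd 2 k).comp 1 = X 1) {r : k}
    (hr : r ≠ 0) {q : MvPolynomial (Fin 2) k} (hq : q ∈ supported k {1})
    (h0 : (u : PolyEnd 2 k).comp 0 = C r * X 0 + q) : u ∈ Tame 2 k := by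
  have ht : swapAut k * u * swapAut k ∈ Tame 2 k := by
    refine Subgroup.subset_closure (Or.inr ⟨![1, Units.mk0 r hr],
      ![0, bind₁ (swapAut k : PolyEnd 2 k).comp q], fun i => ?_, fun i => ?_⟩)
    · fin_cases i
      · exact (supported k _).zero_mem
      · refine bind₁_mem_supported hq fun j hj => ?_
        obtain rfl : j = 1 := hj
        rw [swapAut_comp_one]
        exact X_mem_supported' (by simp)
    · simp only [Units.val_mul, mul_comp]
      fin_cases i
      · simp [swapAut_comp_zero, h1, swapAut_comp_one]
      · simp [swapAut_comp_zero, h0, swapAut_comp_one]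
  have e : u = (swapAut k)⁻¹ * (swapAut k * u * swapAut k) * (swapAut k)⁻¹ := by group
  rw [e]
  exact mul_mem (mul_mem (inv_mem swapAut_mem_tame) ht) (inv_mem swapAut_mem_tame)

theorem shear_mem_tame_two (i : Fin 2) (q : supported k ({i}ᶜ : Set (Fin 2))) :
    shear i q ∈ Tame 2 k := by
  fin_cases i
  · refine mem_tame_of_comp_one_eq_X (r := 1) (q := (q : MvPolynomial (Fin 2) k))
      (shearEnd_comp_of_ne (by simp) _) one_ne_zero
      (supported_mono (fun j hj => ?_) q.2) ?_
    · fin_cases j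
      · exact absurd rfl hj
      · rfl
    · rw [C_1, one_mul]
      exact shearEnd_comp_self _ _
  · refine Subgroup.subset_closure (Or.inr ⟨1, ![0, q], fun i => ?_, fun i => ?_⟩)
    · fin_cases i
      · exact (supported k _).zero_mem
      · refine supported_mono (fun j hj => ?_) q.2
        fin_cases j
        · simp
        · exact absurd rfl hj
    · fin_cases i
      · simpa [shear_val] using shearEnd_comp_of_ne (by simp) (q : MvPolynomial (Fin 2) k)
      · simpa [shear_val] using shearEnd_comp_self 1 (q : MvPolynomial (Fin 2) k)

theorem finSuccEquiv_bind₁_X_one (g : MvPolynomial (Fin 1) k) :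
    finSuccEquiv k 1 (bind₁ (fun _ => X 1) g) = Polynomial.C g := by
  induction g using MvPolynomial.induction_on with
  | C a => simp [finSuccEquiv_apply]
  | add p q hp hq => rw [map_add, map_add, hp, hq, map_add]
  | mul_X p i hp =>
    rw [map_mul, map_mul, hp, map_mul, bind₁_X_right, Subsingleton.elim i 0]
    congr 1
    exact finSuccEquiv_X_succ (j := (0 : Fin 1))

theorem finSuccEquiv_bind₁ {g : Fin 2 → MvPolynomial (Fin 2) k} (hg : g 1 = X 1)
    (p : MvPolynomial (Fin 2) k) :
    finSuccEquiv k 1 (bind₁ g p) = (finSuccEquiv k 1 p).comp (finSuccEquiv k 1 (g 0)) := by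
  have h1 : finSuccEquiv k 1 (X 1) = Polynomial.C (X 0) := finSuccEquiv_X_succ (j := (0 : Fin 1))
  induction p using MvPolynomial.induction_on with
  | C a => simp [finSuccEquiv_apply]
  | add p q hp hq => rw [map_add, map_add, hp, hq, map_add, Polynomial.add_comp]
  | mul_X p i hp =>
    rw [map_mul, map_mul, hp, map_mul, Polynomial.mul_comp, bind₁_X_right]
    congr 1
    fin_cases i
    · simp [finSuccEquiv_X_zero]
    · change finSuccEquiv k 1 (g 1) = (finSuccEquiv k 1 (X 1)).comp _
      rw [hg, h1, Polynomial.C_comp]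

/-- Over `k[x₁]` the first components of `u` and `u⁻¹` are inverse under composition, so their
degrees multiply to one; the linear coefficient is a unit of `k[x₁]`, hence a constant. -/
theorem mem_tame_of_comp_one {u : PolyAut 2 k} (h1 : (u : PolyEnd 2 k).comp 1 = X 1) :
    u ∈ Tame 2 k := by
  have h1' : ((u⁻¹ : PolyAut 2 k) : PolyEnd 2 k).comp 1 = X 1 := by
    have := comp_bind₁_inv u 1
    rwa [h1, bind₁_X_right] at this
  have hcomp := finSuccEquiv_bind₁ h1' ((u : PolyEnd 2 k).comp 0)
  rw [comp_bind₁_inv, finSuccEquiv_X_zero] at hcomp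
  set G := finSuccEquiv k 1 ((u : PolyEnd 2 k).comp 0) with hG
  set F := finSuccEquiv k 1 (((u⁻¹ : PolyAut 2 k) : PolyEnd 2 k).comp 0)
  have hdeg : G.natDegree * F.natDegree = 1 := by
    rw [← Polynomial.natDegree_comp, ← hcomp, Polynomial.natDegree_X]
  have hG1 := Polynomial.eq_X_add_C_of_natDegree_le_one (Nat.eq_one_of_mul_eq_one_right hdeg).le
  have hunit : IsUnit (G.coeff 1) := by
    have h := congrArg (fun p => Polynomial.coeff p 1) hcomp
    rw [hG1] at h
    simp only [Polynomial.coeff_X_one, Polynomial.add_comp, Polynomial.mul_comp,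
      Polynomial.C_comp, Polynomial.X_comp, Polynomial.coeff_add, Polynomial.coeff_C_mul,
      Polynomial.coeff_C_succ, add_zero] at h
    exact IsUnit.of_mul_eq_one _ h.symm
  obtain ⟨r, hr, hGr⟩ := (MvPolynomial.isUnit_iff_eq_C_of_isReduced).1 hunit
  refine mem_tame_of_comp_one_eq_X h1 hr.ne_zero (q := bind₁ (fun _ => X 1) (G.coeff 0)) ?_ ?_
  · exact bind₁_mem_supported (s := Set.univ) (by rw [supported_univ]; trivial)
      fun _ _ => X_mem_supported' rfl
  · refine (finSuccEquiv k 1).injective ?_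
    rw [map_add, map_mul, finSuccEquiv_X_zero, finSuccEquiv_bind₁_X_one, ← hG]
    conv_lhs => rw [hG1, hGr]
    congr 2
    simp [finSuccEquiv_apply]

theorem X_sub_C_dvd_sub (x₀ : k) (p : MvPolynomial (Fin 2) k) :
    X 0 - C x₀ ∣ p - Polynomial.aeval (X 1 : MvPolynomial (Fin 2) k)
      (aeval ![Polynomial.C x₀, Polynomial.X] p) := by
  induction p using MvPolynomial.induction_on with
  | C a => simp
  | add p q hp hq =>
    rw [map_add, map_add, add_sub_add_comm]
    exact dvd_add hp hq
  | mul_X p i hp =>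
    rw [map_mul, map_mul, aeval_X]
    fin_cases i
    · have : p * X 0 - Polynomial.aeval (X 1 : MvPolynomial (Fin 2) k)
          (aeval ![Polynomial.C x₀, Polynomial.X] p) * C x₀ =
          (p - Polynomial.aeval (X 1 : MvPolynomial (Fin 2) k)
          (aeval ![Polynomial.C x₀, Polynomial.X] p)) * C x₀ + p * (X 0 - C x₀) := by ring
      simpa [this] using dvd_add (hp.mul_right (C x₀)) (dvd_mul_left _ p)
    · simpa [sub_mul] using hp.mul_right (X 1)

/-- The restriction of the `i`-th component of the inverse of `f` to the line where the second
coordinate vanishes. -/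
noncomputable def linePoly (f : PolyAut 2 k) (i : Fin 2) : Polynomial k :=
  aeval ![Polynomial.X, 0] (((f⁻¹ : PolyAut 2 k) : PolyEnd 2 k).comp i)

theorem aeval_linePoly (f : PolyAut 2 k) (i : Fin 2) :
    aeval (linePoly f) ((f : PolyEnd 2 k).comp i) = (![Polynomial.X, 0] : Fin 2 → Polynomial k) i := by
  have h := congrArg (aeval (![Polynomial.X, 0] : Fin 2 → Polynomial k)) (comp_bind₁_inv f i)
  rwa [aeval_bind₁, aeval_X] at h

/-- The curve lies on the line with first coordinate `x₀`, and `f₁` vanishes on it, so `X 0 - C x₀`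
divides `f₁`. Being the image of a variable under an automorphism, `f₁` is irreducible, hence a
scalar multiple of this factor. -/
theorem mem_tame_of_linePoly_zero_eq_C {f : PolyAut 2 k} {x₀ : k}
    (hx : linePoly f 0 = Polynomial.C x₀) : f ∈ Tame 2 k := by
  have hcomp : ∀ p : MvPolynomial (Fin 2) k, aeval (linePoly f) p =
      (aeval ![Polynomial.C x₀, Polynomial.X] p : Polynomial k).comp (linePoly f 1) := by
    intro p
    induction p using MvPolynomial.induction_on with
    | C a => simp
    | add p q hp hq => rw [map_add, map_add, hp, hq, Polynomial.add_comp]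
    | mul_X p i hp =>
      rw [map_mul, map_mul, hp, Polynomial.mul_comp, aeval_X, aeval_X]
      congr 1
      fin_cases i
      · simp [hx]
      · simp
  have hY : (linePoly f 1).natDegree ≠ 0 := by
    intro h
    have h0 := aeval_linePoly f 0
    rw [hcomp, Polynomial.eq_C_of_natDegree_eq_zero h, Polynomial.comp_C] at h0
    have := congrArg Polynomial.natDegree h0
    simp at this
  have h1 := aeval_linePoly f 1
  rw [hcomp] at h1
  have hp1 : (aeval ![Polynomial.C x₀, Polynomial.X] ((f : PolyEnd 2 k).comp 1) :
      Polynomial k) = 0 := by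
    rcases Polynomial.comp_eq_zero_iff.1 h1 with h | ⟨-, h⟩
    · exact h
    · exact absurd (by rw [h, Polynomial.natDegree_C]) hY
  obtain ⟨Q, hQ⟩ := X_sub_C_dvd_sub x₀ ((f : PolyEnd 2 k).comp 1)
  rw [hp1, map_zero, sub_zero] at hQ
  have hX := comp_bind₁_inv f 1
  rw [hQ, map_mul, map_sub, bind₁_X_right, bind₁_C_right] at hX
  have hirr : Irreducible (X 1 : MvPolynomial (Fin 2) k) := X_prime.irreducible
  rcases hirr.isUnit_or_isUnit hX.symm with hu | hu
  · exfalso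
    obtain ⟨c, -, hc⟩ := (MvPolynomial.isUnit_iff_eq_C_of_isReduced).1 hu
    have h := inv_bind₁_comp f 0
    rw [sub_eq_iff_eq_add.1 hc, map_add, bind₁_C_right, bind₁_C_right, ← C_add] at h
    have := congrArg totalDegree h
    rw [totalDegree_C, totalDegree_X] at this
    exact zero_ne_one this
  · obtain ⟨r, hr, hQr⟩ := (MvPolynomial.isUnit_iff_eq_C_of_isReduced).1 hu
    rw [hQr] at hX
    -- `A` is affine with the same second component as `f`, so `A * f⁻¹` fixes `x₁`.
    let A : PolyAut 2 k := shear 1 ⟨C (-r * x₀), C_mem_supported _ _⟩ *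
      diag 2 k ![1, hr.unit] * swapAut k
    have hA : A ∈ Tame 2 k := by
      refine mul_mem (mul_mem (shear_mem_tame_two _ _) (Subgroup.subset_closure (Or.inr
        ⟨![1, hr.unit], 0, fun i => (supported k _).zero_mem, fun i => ?_⟩))) swapAut_mem_tame
      rw [diag_comp, Pi.zero_apply, add_zero]
    have hAf : A * f⁻¹ ∈ Tame 2 k := by
      refine mem_tame_of_comp_one ?_
      simp only [A, Units.val_mul, mul_comp, shear_val, shearEnd_comp_self, map_add, bind₁_X_right,
        diag_comp, map_mul, bind₁_C_right, swapAut_comp_one]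
      rw [← hX]
      simp
      ring
    have := mul_mem (inv_mem hAf) hA
    rwa [mul_inv_rev, inv_inv, inv_mul_cancel_right] at this

theorem linePoly_mul_shear (f : PolyAut 2 k) (i : Fin 2) (q : supported k ({i}ᶜ : Set (Fin 2))) :
    linePoly (f * shear i q) i = linePoly f i - aeval (linePoly f) (q : MvPolynomial (Fin 2) k) := by
  simp only [linePoly, mul_inv_rev, Units.val_mul, mul_comp, aeval_bind₁]
  rw [shear_inv_val, shearEnd_comp_self, map_add, aeval_X, map_neg, sub_eq_add_neg]
  rfl

theorem linePoly_mul_shear_of_ne (f : PolyAut 2 k) {i j : Fin 2} (hj : j ≠ i)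
    (q : supported k ({i}ᶜ : Set (Fin 2))) : linePoly (f * shear i q) j = linePoly f j := by
  simp only [linePoly, mul_inv_rev, Units.val_mul, mul_comp, aeval_bind₁]
  rw [shear_inv_val, shearEnd_comp_of_ne hj, aeval_X]

theorem linePoly_mul_swapAut (f : PolyAut 2 k) :
    linePoly (f * swapAut k) 0 = linePoly f 1 := by
  simp only [linePoly, mul_inv_rev, Units.val_mul, mul_comp]
  rw [swapAut_inv, swapAut_comp_zero, bind₁_X_right]

/-- A monomial of weight `M` becomes a polynomial of degree at most `g * M`, so only the weight `N`
reaches the top coefficient, through the leading coefficients of the curve. -/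
theorem coeff_aeval_eq_eval_component {a b g : ℕ} (hg : 0 < g) {p : Fin 2 → Polynomial k}
    (h0 : (p 0).natDegree = g * b) (h1 : (p 1).natDegree = g * a)
    {F : MvPolynomial (Fin 2) k} {N : ℕ} (hF : WeightLE (planeWeight a b) F N) :
    (aeval p F).coeff (g * N) = eval ![(p 0).leadingCoeff, (p 1).leadingCoeff]
      (weightedHomogeneousComponent (planeWeight a b) (N : ℚ) F) := by
  have hcomp : weightedHomogeneousComponent (planeWeight a b) (N : ℚ) F = ∑ m ∈ F.support,
      weightedHomogeneousComponent (planeWeight a b) (N : ℚ) (monomial m (coeff m F)) := by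
    conv_lhs => rw [F.as_sum, map_sum]
  rw [hcomp, map_sum]
  conv_lhs => rw [F.as_sum, map_sum, Polynomial.finsetSum_coeff]
  refine Finset.sum_congr rfl fun m hm => ?_
  have hw := hF m hm
  rw [weight_planeWeight, Nat.cast_le] at hw
  rw [weightedHomogeneousComponent_of_mem
    (isWeightedHomogeneous_monomial _ _ _ (weight_planeWeight a b m))]
  have hdeg : (p 0 ^ m 0 * p 1 ^ m 1).natDegree ≤ g * (b * m 0 + a * m 1) := by
    refine Polynomial.natDegree_mul_le.trans (le_of_le_of_eq (add_le_add
      Polynomial.natDegree_pow_le Polynomial.natDegree_pow_le) ?_)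
    rw [h0, h1]
    ring
  rw [monomial_fin_two]
  simp only [map_mul, map_pow, aeval_X, aeval_C, Polynomial.algebraMap_eq, Polynomial.coeff_C_mul]
  split_ifs with h
  · have h : N = b * m 0 + a * m 1 := by exact_mod_cast h
    have e : g * N = m 0 * (g * b) + m 1 * (g * a) := by
      rw [h]
      ring
    have e0 := Polynomial.coeff_pow_of_natDegree_le (m := m 0) h0.le
    have e1 := Polynomial.coeff_pow_of_natDegree_le (m := m 1) h1.le
    rw [e, Polynomial.coeff_mul_add_eq_of_natDegree_le
      (Polynomial.natDegree_pow_le_of_le _ h0.le) (Polynomial.natDegree_pow_le_of_le _ h1.le), e0, e1]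
    simp [Polynomial.leadingCoeff, h0, h1]
  · have h : N ≠ b * m 0 + a * m 1 := by exact_mod_cast h
    rw [map_zero (eval _)]
    refine mul_eq_zero_of_right _ (Polynomial.coeff_eq_zero_of_natDegree_lt (hdeg.trans_lt ?_))
    exact Nat.mul_lt_mul_of_pos_left (lt_of_le_of_ne hw h.symm) hg

theorem exists_weightLE_component_ne_zero (a b : ℕ) {F : MvPolynomial (Fin 2) k} (hF : F ≠ 0) :
    ∃ N : ℕ, WeightLE (planeWeight a b) F N ∧
      weightedHomogeneousComponent (planeWeight a b) (N : ℚ) F ≠ 0 := by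
  obtain ⟨m, hm, hmax⟩ := F.support.exists_max_image (fun m => b * m 0 + a * m 1)
    (support_nonempty.2 hF)
  refine ⟨b * m 0 + a * m 1, fun m' hm' => ?_, fun h => ?_⟩
  · rw [weight_planeWeight, Nat.cast_le]
    exact hmax m' hm'
  · have := congrArg (coeff m) h
    rw [coeff_weightedHomogeneousComponent, if_pos (weight_planeWeight a b m), coeff_zero] at this
    exact mem_support_iff.1 hm this

/-- The automorphism of the coordinate ring that maps the components of `f` to the variables. -/
noncomputable def autEquiv {n : ℕ} (f : PolyAut n k) :
    MvPolynomial (Fin n) k ≃ₐ[k] MvPolynomial (Fin n) k :=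
  AlgEquiv.ofAlgHom (bind₁ ((f⁻¹ : PolyAut n k) : PolyEnd n k).comp) (bind₁ (f : PolyEnd n k).comp)
    (by ext1 i; simp [comp_bind₁_inv])
    (by ext1 i; simp [inv_bind₁_comp])

/-- With `a`, `b` the degrees divided by their gcd, the top form of `f₁` vanishes at the leading
coefficients because `f₁` vanishes along the curve. -/
theorem natDegree_linePoly_eq_mul {f : PolyAut 2 k} (h0 : (linePoly f 0).natDegree ≠ 0)
    (h1 : (linePoly f 1).natDegree ≠ 0) :
    (∃ b, (linePoly f 0).natDegree = b * (linePoly f 1).natDegree) ∨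
      ∃ a, (linePoly f 1).natDegree = a * (linePoly f 0).natDegree := by
  obtain ⟨b, a, hab, hb, ha⟩ := Nat.exists_coprime (linePoly f 0).natDegree (linePoly f 1).natDegree
  set g := (linePoly f 0).natDegree.gcd (linePoly f 1).natDegree
  have ha0 : 0 < a := Nat.pos_of_ne_zero fun h => h1 (by rw [ha, h, zero_mul])
  have hb0 : 0 < b := Nat.pos_of_ne_zero fun h => h0 (by rw [hb, h, zero_mul])
  have hne : ∀ {i}, (linePoly f i).natDegree ≠ 0 → (linePoly f i).leadingCoeff ≠ 0 := fun h hl =>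
    h (by rw [Polynomial.leadingCoeff_eq_zero.1 hl, Polynomial.natDegree_zero])
  have hf1 : (f : PolyEnd 2 k).comp 1 ≠ 0 := by
    intro h
    have := comp_bind₁_inv f 1
    rw [h, map_zero] at this
    exact X_ne_zero 1 this.symm
  obtain ⟨N, hN, hN0⟩ := exists_weightLE_component_ne_zero a b hf1
  have hg : 0 < g := Nat.gcd_pos_of_pos_left _ (Nat.pos_of_ne_zero h0)
  have hev := coeff_aeval_eq_eval_component hg (by rw [hb, mul_comm]) (by rw [ha, mul_comm]) hN
  rw [aeval_linePoly] at hev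
  -- In the coordinates `(f₀, f₁)`, with `f₀` as the polynomial variable, `f₁` is a constant.
  have hE : (((autEquiv f).trans (finSuccEquiv k 1)) ((f : PolyEnd 2 k).comp 1)).natDegree = 0 := by
    have : (autEquiv f) ((f : PolyEnd 2 k).comp 1) = X 1 := comp_bind₁_inv f 1
    rw [AlgEquiv.trans_apply, this, show finSuccEquiv k 1 (X 1) = Polynomial.C (X 0) from
      finSuccEquiv_X_succ (j := (0 : Fin 1)), Polynomial.natDegree_C]
  rcases eq_one_or_eq_one_of_eval_component_eq_zero ha0 hb0 hab.symm (hne h0) (hne h1) hE hN hN0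
    (hev.symm.trans (by simp)) with rfl | rfl
  · exact Or.inl ⟨b, by rw [ha, one_mul]; exact hb⟩
  · exact Or.inr ⟨a, by rw [hb, one_mul]; exact ha⟩

theorem natDegree_sub_C_mul_pow_lt {p q : Polynomial k} {b : ℕ} (hp : p.natDegree ≠ 0)
    (h : p.natDegree = b * q.natDegree) :
    (p - Polynomial.C (p.leadingCoeff / q.leadingCoeff ^ b) * q ^ b).natDegree < p.natDegree := by
  have hp0 : p ≠ 0 := by
    rintro rfl
    exact hp Polynomial.natDegree_zero
  have hq0 : q.leadingCoeff ^ b ≠ 0 := by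
    refine pow_ne_zero _ fun hq => hp ?_
    rw [h, Polynomial.leadingCoeff_eq_zero.1 hq, Polynomial.natDegree_zero, mul_zero]
  have hc : p.leadingCoeff / q.leadingCoeff ^ b ≠ 0 :=
    div_ne_zero (Polynomial.leadingCoeff_ne_zero.2 hp0) hq0
  have hr : (Polynomial.C (p.leadingCoeff / q.leadingCoeff ^ b) * q ^ b).natDegree =
      p.natDegree := by
    rw [Polynomial.natDegree_C_mul hc, Polynomial.natDegree_pow, h]
  have hlead : p.leadingCoeff =
      (Polynomial.C (p.leadingCoeff / q.leadingCoeff ^ b) * q ^ b).leadingCoeff := by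
    rw [Polynomial.leadingCoeff_mul, Polynomial.leadingCoeff_C, Polynomial.leadingCoeff_pow,
      div_mul_cancel₀ _ hq0]
  have hr0 : Polynomial.C (p.leadingCoeff / q.leadingCoeff ^ b) * q ^ b ≠ 0 := by
    intro h
    rw [h, Polynomial.natDegree_zero] at hr
    exact hp hr.symm
  by_cases h0 : p - Polynomial.C (p.leadingCoeff / q.leadingCoeff ^ b) * q ^ b = 0
  · rw [h0, Polynomial.natDegree_zero]
    exact Nat.pos_of_ne_zero hp
  · refine Polynomial.natDegree_lt_natDegree h0 (Polynomial.degree_sub_lt_left ?_ hp0 hlead)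
    rw [Polynomial.degree_eq_natDegree hp0, Polynomial.degree_eq_natDegree hr0, hr]

theorem exists_shear_natDegree_lt {f : PolyAut 2 k} {i j : Fin 2} (hij : j ≠ i)
    (hi : (linePoly f i).natDegree ≠ 0) {b : ℕ}
    (h : (linePoly f i).natDegree = b * (linePoly f j).natDegree) :
    ∃ q, (linePoly (f * shear i q) i).natDegree < (linePoly f i).natDegree := by
  refine ⟨⟨C ((linePoly f i).leadingCoeff / (linePoly f j).leadingCoeff ^ b) * X j ^ b,
    mul_mem (C_mem_supported _ _) (pow_mem (X_mem_supported' hij) _)⟩, ?_⟩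
  rw [linePoly_mul_shear]
  simpa using natDegree_sub_C_mul_pow_lt hi h

/-- The theorem of Jung and van der Kulk. -/
theorem mem_tame_two (f : PolyAut 2 k) : f ∈ Tame 2 k := by
  induction hd : (linePoly f 0).natDegree + (linePoly f 1).natDegree using Nat.strong_induction_on
    generalizing f with
  | _ d ih =>
  have key : ∀ i j : Fin 2, j ≠ i → (∃ q, (linePoly (f * shear i q) i).natDegree <
      (linePoly f i).natDegree) → f ∈ Tame 2 k := by
    rintro i j hij ⟨q, hq⟩
    have hj := linePoly_mul_shear_of_ne f hij q
    refine ((Tame 2 k).mul_mem_cancel_right (shear_mem_tame_two i q)).1 (ih _ ?_ _ rfl)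
    rw [← Fin.sum_univ_two (fun i => (linePoly f i).natDegree)] at hd
    rw [← hd, ← Fin.sum_univ_two (fun i' => (linePoly (f * shear i q) i').natDegree)]
    refine Finset.sum_lt_sum (fun l _ => ?_) ⟨i, Finset.mem_univ _, hq⟩
    rcases eq_or_ne l i with rfl | hl
    · exact hq.le
    · rw [linePoly_mul_shear_of_ne f hl]
  by_cases h0 : (linePoly f 0).natDegree = 0
  · exact mem_tame_of_linePoly_zero_eq_C (Polynomial.eq_C_of_natDegree_eq_zero h0)
  by_cases h1 : (linePoly f 1).natDegree = 0
  · refine ((Tame 2 k).mul_mem_cancel_right swapAut_mem_tame).1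
      (mem_tame_of_linePoly_zero_eq_C (x₀ := (linePoly f 1).coeff 0) ?_)
    rw [linePoly_mul_swapAut]
    exact Polynomial.eq_C_of_natDegree_eq_zero h1
  rcases natDegree_linePoly_eq_mul h0 h1 with ⟨b, hb⟩ | ⟨a, ha⟩
  · exact key 0 1 one_ne_zero (exists_shear_natDegree_lt one_ne_zero h0 hb)
  · exact key 1 0 zero_ne_one (exists_shear_natDegree_lt zero_ne_one h1 ha)

end Tame

/-! ### The line in characteristic zero, and the conclusion. -/

section Main

universe u

variable {n : ℕ} {k : Type u} [Field k]

theorem exists_comp_eq_X_add_C_of_jac_eq_one [CharZero k] {f : PolyAut 1 k} (hf : f ∈ SAut 1 k) :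
    ∃ b : k, ∀ i, (f : PolyEnd 1 k).comp i = X i + C b := by
  have hj : pderiv 0 ((f : PolyEnd 1 k).comp 0) = 1 := by
    have h : jac (f : PolyEnd 1 k) = 1 := hf
    rwa [jac, Matrix.det_fin_one] at h
  set p := (f : PolyEnd 1 k).comp 0
  have hp : pderiv 0 (p - X 0) = 0 := by rw [map_sub, hj, pderiv_X_self, sub_self]
  refine ⟨coeff 0 (p - X 0), fun i => ?_⟩
  obtain rfl : i = 0 := Subsingleton.elim _ _
  change p = _
  rw [← sub_eq_iff_eq_add']
  ext m
  rw [coeff_C]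
  split_ifs with h
  · rw [h]
  · have hm : m 0 ≠ 0 := fun h0 => h (Finsupp.ext fun i => by
      rw [Subsingleton.elim i 0, h0, Finsupp.zero_apply])
    have h1 := congrArg (coeff (m - Finsupp.single 0 1)) hp
    rw [coeff_pderiv, coeff_zero, tsub_add_cancel_of_le] at h1
    · rcases mul_eq_zero.1 h1 with h1 | h1
      · exact h1
      · exact absurd h1 (Nat.cast_add_one_ne_zero _)
    · rw [Finsupp.single_le_iff]
      exact Nat.one_le_iff_ne_zero.2 hm

/-- The powers of a translation by `b` are the members of the family `x + t b` at the natural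
numbers, which are infinitely many in characteristic zero; every translation belongs to this family.
-/
theorem IsLimitClosedNormal.eq_SAut_one [CharZero k] {P : Subgroup (PolyAut 1 k)}
    (hP : IsLimitClosedNormal P) (hne : P ≠ ⊥) : SAut 1 k ≤ P := by
  obtain ⟨⟨f, hf⟩, hf1⟩ := Subgroup.ne_bot_iff_exists_ne_one.1 hne
  obtain ⟨b, hb⟩ := exists_comp_eq_X_add_C_of_jac_eq_one (hP.le_SAut hf)
  have hb0 : b ≠ 0 := by
    rintro rfl
    refine hf1 (Subtype.ext (PolyAut.ext_comp fun i => ?_))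
    change (f : PolyEnd 1 k).comp i = _
    rw [hb, C_0, add_zero]
    rfl
  intro g hg
  obtain ⟨c, hc⟩ := exists_comp_eq_X_add_C_of_jac_eq_one hg
  refine hP.limit_mem (fun i => X (some i) + X none * C b) ?_ g hg (c / b) fun i => ?_
  · refine (Set.infinite_range_of_injective (Nat.cast_injective (R := k))).mono ?_
    rintro _ ⟨m, rfl⟩
    refine ⟨f ^ m, pow_mem hf m, fun i => ?_⟩
    rw [map_add, map_mul, spec_X_some, spec_X_none, spec_C, ← C_mul]
    induction m with
    | zero => simp [one_comp]
    | succ m ih =>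
      rw [pow_succ', Units.val_mul, mul_comp, hb, map_add, bind₁_X_right, bind₁_C_right, ih]
      push_cast
      rw [add_assoc, ← C_add]
      congr 2
      ring
  · rw [hc, map_add, map_mul, spec_X_some, spec_X_none, spec_C, ← C_mul, div_mul_cancel₀ _ hb0]

theorem eq_bot_or_forall_mem_of_isClosed [Infinite k] (hn : 2 ≤ n ∨ n = 1 ∧ CharZero k)
    {N : Subgroup (SAut n k)} (hN : N.Normal)
    (hcl : IsClosed[shafarevichSAut n k] (N : Set (SAut n k))) :
    N = ⊥ ∨ ∀ f : SAut n k, (f : PolyAut n k) ∈ Tame n k → f ∈ N := by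
  by_cases hne : N = ⊥
  · exact Or.inl hne
  refine Or.inr fun f hf => ?_
  have hP := isLimitClosedNormal_map_subtype hN hcl
  have hPne : N.map (SAut n k).subtype ≠ ⊥ := by
    rwa [Ne, Subgroup.map_eq_bot_iff_of_injective _ (SAut n k).subtype_injective]
  have hfP : (f : PolyAut n k) ∈ N.map (SAut n k).subtype := by
    rcases hn with hn | ⟨rfl, hn⟩
    · have := Fin.nontrivial_iff_two_le.2 hn
      exact hP.elementary_le hPne (mem_elementary_of_mem_tame hf f.2)
    · exact hP.eq_SAut_one hPne f.2
  exact (Subgroup.mem_map_iff_mem (SAut n k).subtype_injective).1 hfP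

theorem nontrivial_SAut_two : Nontrivial (SAut 2 k) := by
  refine ⟨1, ⟨shear 0 ⟨C 1, C_mem_supported _ 1⟩, shear_mem_SAut _ _⟩, fun h => ?_⟩
  have h := congrArg (fun g : SAut 2 k => ((g : PolyAut 2 k) : PolyEnd 2 k).comp 0) h
  simp [shear_val, shearEnd_comp_self, one_comp] at h

theorem isTopologicallySimple_SAut_two [Infinite k] {t : TopologicalSpace (SAut 2 k)}
    (ht : ∀ N : Set (SAut 2 k), IsClosed[t] N → IsClosed[shafarevichSAut 2 k] N) :
    IsTopologicallySimple (SAut 2 k) t := by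
  refine ⟨nontrivial_SAut_two, fun N hN hcl => ?_⟩
  refine (eq_bot_or_forall_mem_of_isClosed (Or.inl le_rfl) hN (ht _ hcl)).imp_right fun h => ?_
  exact eq_top_iff.2 fun f _ => h f (mem_tame_two (f : PolyAut 2 k))

end Main

end AffineSpaceAut

theorem mainTheorem1 {k : Type*} [Field k] [Infinite k] :
    (∀ n : ℕ, (2 ≤ n ∨ (n = 1 ∧ CharZero k)) →
      ∀ N : Subgroup (AffineSpaceAut.SAut n k), N.Normal →
        (IsClosed[AffineSpaceAut.shafarevichSAut n k] (N : Set (AffineSpaceAut.SAut n k)) ∨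
          IsClosed[AffineSpaceAut.kambayashiSAut n k] (N : Set (AffineSpaceAut.SAut n k))) →
        N = ⊥ ∨
          ∀ f : AffineSpaceAut.SAut n k,
            (f : AffineSpaceAut.PolyAut n k) ∈ AffineSpaceAut.Tame n k → f ∈ N) ∧
    AffineSpaceAut.IsTopologicallySimple (AffineSpaceAut.SAut 2 k)
      (AffineSpaceAut.shafarevichSAut 2 k) ∧
    AffineSpaceAut.IsTopologicallySimple (AffineSpaceAut.SAut 2 k)
      (AffineSpaceAut.kambayashiSAut 2 k) := by
  refine ⟨fun n hn N hN hcl => AffineSpaceAut.eq_bot_or_forall_mem_of_isClosed hn hN ?_,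
    AffineSpaceAut.isTopologicallySimple_SAut_two fun _ h => h,
    AffineSpaceAut.isTopologicallySimple_SAut_two fun _ h =>
      AffineSpaceAut.isClosed_shafarevichSAut_of_kambayashiSAut h⟩
  exact hcl.elim id AffineSpaceAut.isClosed_shafarevichSAut_of_kambayashiSAut
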